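/- Let $1<p<N$ and let $\Omega\subset\mathbb R^N$ be a bounded open set (no regularity of $\partial\Omega$ is needed). Let $H:\mathbb R^N\to\mathbb R$ satisfy: (Hh1) $H$ is of class $C^2$ on $\mathbb R^N\setminus\{0\}$, even, and $H(\xi)>0$ for all $\xi\ne 0$; (Hh2) $H(t\xi)=tH(\xi)$ for all $\xi\neq 0$ and $t>0$; (Hh3) there is $\lambda>0$ such that $D^2H(\xi)\zeta\cdot\zeta\ge\lambda|\zeta|^2$ for all $\xi\in\partial\{H<1\}$ and all $\zeta\in\nabla H(\xi)^\perp$. Let $F:\Omega\times(0,+\infty)\to[0,+\infty)$ be a Carathéodory function, that is, $s\mapsto F(x,s)$ is continuous for a.e. $x\in\Omega$ and $x\mapsto F(x,s)$ is measurable for every $s>0$, and assume that for a.e. $x\in\Omega$ the map $s\mapsto F(x,s)/s^{p-1}$ is strictly decreasing on $(0,+\infty)$. Consider the problem $$-\operatorname{div}\big(H^{p-1}(\nabla u)\nabla H(\nabla u)\big)=F(x,u)\ \text{ in }\Omega,\qquad u=0\ \text{ on }\partial\Omega .$$ A weak solution is a function $u\in W^{1,p}_0(\Omega)$ (the closure of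 $C^\infty_c(\Omega)$ in $W^{1,p}(\Omega)$) such that $u>0$ a.e. in $\Omega$, $F(x,u)\in L^1_{\rm loc}(\Omega)$ and $$\int_\Omega H^{p-1}(\nabla u)\nabla H(\nabla u)\cdot\nabla\varphi\,dx=\int_\Omega F(x,u)\,\varphi\,dx\qquad\text{for all }\varphi\in C^1_c(\Omega),$$ where $H^{p-1}(\nabla u)\nabla H(\nabla u)$ is understood to be $0$ where $\nabla u=0$. Then there is at most one weak solution: any two weak solutions coincide a.e. in $\Omega$. -/

import Mathlib

open MeasureTheory Set Filter Topology

/-- Assumptions on the anisotropy `H : ℝᴺ → ℝ`: it is even, positive and `C²` away from the origin,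
positively homogeneous of degree one, and uniformly elliptic, that is, the Hessian of `H` at the
points of the boundary of `{H < 1}` is uniformly positive definite on the orthogonal complement
of `∇H`. -/
structure IsFinslerNorm {N : ℕ} (H : EuclideanSpace ℝ (Fin N) → ℝ) : Prop where
  contDiffOn : ContDiffOn ℝ 2 H {0}ᶜ
  even : ∀ ξ, H (-ξ) = H ξ
  pos : ∀ ξ, ξ ≠ 0 → 0 < H ξ
  homogeneous : ∀ ξ, ξ ≠ 0 → ∀ t : ℝ, 0 < t → H (t • ξ) = t * H ξ
  elliptic : ∃ lam : ℝ, 0 < lam ∧ ∀ ξ ∈ frontier {η | H η < 1}, ∀ ζ,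
    inner ℝ (gradient H ξ) ζ = 0 → lam * ‖ζ‖ ^ 2 ≤ fderiv ℝ (fderiv ℝ H) ξ ζ ζ

/-- The vector field `ξ ↦ H(ξ)^(p-1) ∇H(ξ)`. For an even `H` its value at `0` is `0`,
see `finslerFlux_zero`. -/
noncomputable def finslerFlux {N : ℕ} (H : EuclideanSpace ℝ (Fin N) → ℝ) (p : ℝ)
    (ξ : EuclideanSpace ℝ (Fin N)) : EuclideanSpace ℝ (Fin N) :=
  (H ξ) ^ (p - 1) • gradient H ξ

theorem finslerFlux_zero {N : ℕ} {H : EuclideanSpace ℝ (Fin N) → ℝ} (hH : IsFinslerNorm H)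
    (p : ℝ) : finslerFlux H p 0 = 0 := by
  have h4 : fderiv ℝ H 0 = 0 := by
    by_cases hd : DifferentiableAt ℝ H 0
    · have hc : HasFDerivAt (fun ξ => H (-ξ)) ((fderiv ℝ H 0).comp
          (-ContinuousLinearMap.id ℝ (EuclideanSpace ℝ (Fin N)))) 0 :=
        HasFDerivAt.comp (g := H) 0 (by simpa using hd.hasFDerivAt) (hasFDerivAt_id 0).neg
      rw [show (fun ξ => H (-ξ)) = H from funext hH.even] at hc
      ext e
      have he := DFunLike.congr_fun hc.fderiv e
      simp at he
      simp
      linarith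
    · exact fderiv_zero_of_not_differentiableAt hd
  simp [finslerFlux, gradient, h4]

/-- `φ ∈ Cⁿ_c(Ω)`; functions with compact support in `Ω` are extended by zero to `ℝᴺ`. -/
structure IsTestFun {N : ℕ} (n : ℕ∞) (Ω : Set (EuclideanSpace ℝ (Fin N)))
    (φ : EuclideanSpace ℝ (Fin N) → ℝ) : Prop where
  contDiff : ContDiff ℝ n φ
  hasCompactSupport : HasCompactSupport φ
  tsupport_subset : tsupport φ ⊆ Ω

/-- `G` is the weak (distributional) gradient of `u` in `Ω`. -/
structure IsWeakGradient {N : ℕ} (Ω : Set (EuclideanSpace ℝ (Fin N)))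
    (u : EuclideanSpace ℝ (Fin N) → ℝ)
    (G : EuclideanSpace ℝ (Fin N) → EuclideanSpace ℝ (Fin N)) : Prop where
  locallyIntegrableOn : LocallyIntegrableOn u Ω volume
  locallyIntegrableOn_grad : LocallyIntegrableOn G Ω volume
  integral_eq : ∀ φ, IsTestFun ⊤ Ω φ → ∀ e : EuclideanSpace ℝ (Fin N),
    ∫ x in Ω, u x * fderiv ℝ φ x e = -∫ x in Ω, inner ℝ (G x) e * φ x

/-- `u ∈ W^{1,p}(Ω)`, with weak gradient `G`. -/
structure MemSobolev {N : ℕ} (p : ℝ) (Ω : Set (EuclideanSpace ℝ (Fin N)))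
    (u : EuclideanSpace ℝ (Fin N) → ℝ)
    (G : EuclideanSpace ℝ (Fin N) → EuclideanSpace ℝ (Fin N)) : Prop where
  memLp : MemLp u (ENNReal.ofReal p) (volume.restrict Ω)
  memLp_grad : MemLp G (ENNReal.ofReal p) (volume.restrict Ω)
  isWeakGradient : IsWeakGradient Ω u G

/-- `u ∈ W^{1,p}_0(Ω)`, with weak gradient `G`: the function `u` lies in `W^{1,p}(Ω)` and is a limit
of functions of class `C^∞_c(Ω)` in the norm of `W^{1,p}(Ω)`. -/
structure MemSobolevZero {N : ℕ} (p : ℝ) (Ω : Set (EuclideanSpace ℝ (Fin N)))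
    (u : EuclideanSpace ℝ (Fin N) → ℝ)
    (G : EuclideanSpace ℝ (Fin N) → EuclideanSpace ℝ (Fin N)) : Prop where
  memSobolev : MemSobolev p Ω u G
  exists_approx : ∃ φ : ℕ → EuclideanSpace ℝ (Fin N) → ℝ, (∀ n, IsTestFun ⊤ Ω (φ n)) ∧
    Tendsto (fun n => eLpNorm (fun x => φ n x - u x) (ENNReal.ofReal p) (volume.restrict Ω))
      atTop (𝓝 0) ∧
    Tendsto (fun n => eLpNorm (fun x => gradient (φ n) x - G x) (ENNReal.ofReal p)
      (volume.restrict Ω)) atTop (𝓝 0)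

/-- `F : Ω × (0, ∞) → [0, ∞)` is a Carathéodory function. The values `F x s` for `x ∉ Ω` or `s ≤ 0`
play no role. -/
structure IsCaratheodory {N : ℕ} (Ω : Set (EuclideanSpace ℝ (Fin N)))
    (F : EuclideanSpace ℝ (Fin N) → ℝ → ℝ) : Prop where
  nonneg : ∀ x ∈ Ω, ∀ s : ℝ, 0 < s → 0 ≤ F x s
  continuousOn : ∀ᵐ x ∂(volume.restrict Ω), ContinuousOn (F x) (Ioi 0)
  aemeasurable : ∀ s : ℝ, 0 < s → AEMeasurable (fun x => F x s) (volume.restrict Ω)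

/-- `u` is a (positive) weak solution of `-div (H(∇u)^(p-1) ∇H(∇u)) = F(x, u)` in `Ω`, `u = 0` on
`∂Ω`. -/
def IsWeakSolution {N : ℕ} (H : EuclideanSpace ℝ (Fin N) → ℝ) (p : ℝ)
    (Ω : Set (EuclideanSpace ℝ (Fin N))) (F : EuclideanSpace ℝ (Fin N) → ℝ → ℝ)
    (u : EuclideanSpace ℝ (Fin N) → ℝ) : Prop :=
  ∃ G : EuclideanSpace ℝ (Fin N) → EuclideanSpace ℝ (Fin N),
    MemSobolevZero p Ω u G ∧
    (∀ᵐ x ∂(volume.restrict Ω), 0 < u x) ∧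
    LocallyIntegrableOn (fun x => F x (u x)) Ω volume ∧
    ∀ φ, IsTestFun 1 Ω φ →
      ∫ x in Ω, inner ℝ (finslerFlux H p (G x)) (gradient φ x) = ∫ x in Ω, F x (u x) * φ x

/-!
Two positive solutions are compared by testing their equations with quotients adapted to the
`p`-homogeneity of the operator, in the spirit of Brezis-Oswald, Díaz-Saá and Picone. Formally, put
`x = (u - v)⁺ / u` and test the equation of `u` with `u x²` and that of `v` with
`v (u / v)^p x² = (u / v)^(p-1) u x²`. Subtracting,

  `∫ (I - J) = ∫ (F(x, u) / u^(p-1) - F(x, v) / v^(p-1)) u^p x²`,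

where `I` and `J` are the energy densities of the two test functions. The right-hand side is
negative unless `u ≤ v` almost everywhere (`source_mul_lt`), whereas `J ≤ I` pointwise
(`lower_density_le_upper_density`). Exchanging `u` and `v` gives uniqueness.

The pointwise inequality rests on the convexity of `H ^ p`, in the form
`p A(ζ) · ξ ≤ A(ξ) · ξ + (p - 1) A(ζ) · ζ` for the flux `A` (`inner_finslerFlux_le`). Ellipticity is
used only to see that the Hessian of `H` is nonnegative, so that `H` is convex
(`IsFinslerNorm.fderiv_apply_le`).

The test functions above have to be regularized, and no regularity or boundedness of solutions is
available. Positive elements of `W^{1,p}_0(Ω)` are limits of nonnegative test functions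
(`MemSobolevZero.exists_isTestLimit`), and such limits are stable under `C¹` functions of two
variables with bounded partial derivatives (`IsQuadrantC1.isTestLimit_comp`), because these map
`C¹_c(Ω)` to itself; neither truncation nor mollification is needed. Since `F ≥ 0`, all such limits
are admissible in the equation although `F(x, u)` is only locally integrable: Fatou's lemma gives one
inequality, and approximation from below by functions that are bounded by a test function gives the
other (`HasDivergence.integral_eq_of_isTestLimit`).

In the equation of `v`, the larger function `u` is replaced by the bounded function `u / (1 + ε u)`,
and `u` and `v` in the denominators are shifted by `ε`. The energy density of this regularized test
function is at most `3 A(∇u) · ∇u`, uniformly in `ε` (`lower_density_le`), so that Fatou's lemma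
allows `ε → 0` (`IsWeakSolution.ae_le`).
-/

/-! ### Convexity of the anisotropy and properties of the flux -/

namespace IsFinslerNorm

variable {N : ℕ} {H : EuclideanSpace ℝ (Fin N) → ℝ}

theorem contDiffAt (hH : IsFinslerNorm H) {ξ : EuclideanSpace ℝ (Fin N)} (hξ : ξ ≠ 0) :
    ContDiffAt ℝ 2 H ξ :=
  hH.contDiffOn.contDiffAt (isOpen_compl_singleton.mem_nhds hξ)

theorem differentiableAt (hH : IsFinslerNorm H) {ξ : EuclideanSpace ℝ (Fin N)} (hξ : ξ ≠ 0) :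
    DifferentiableAt ℝ H ξ :=
  (hH.contDiffAt hξ).differentiableAt (by norm_num)

theorem differentiableAt_fderiv (hH : IsFinslerNorm H) {ξ : EuclideanSpace ℝ (Fin N)}
    (hξ : ξ ≠ 0) : DifferentiableAt ℝ (fderiv ℝ H) ξ :=
  ((hH.contDiffAt hξ).fderiv_right (m := 1) (by norm_num)).differentiableAt (by norm_num)

theorem fderiv_smul (hH : IsFinslerNorm H) {ξ : EuclideanSpace ℝ (Fin N)} (hξ : ξ ≠ 0) {t : ℝ}
    (ht : 0 < t) : fderiv ℝ H (t • ξ) = fderiv ℝ H ξ := by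
  have h1 : (fun η => H (t • η)) =ᶠ[𝓝 ξ] fun η => t • H η := by
    filter_upwards [isOpen_compl_singleton.mem_nhds hξ] with η hη
    exact hH.homogeneous η hη t ht
  have h2 := h1.fderiv_eq (𝕜 := ℝ)
  rw [fderiv_comp_smul, fderiv_fun_const_smul (hH.differentiableAt hξ)] at h2
  exact smul_right_injective _ ht.ne' h2

/-- Euler's identity for the `1`-homogeneous function `H`. -/
theorem fderiv_self (hH : IsFinslerNorm H) {ξ : EuclideanSpace ℝ (Fin N)} (hξ : ξ ≠ 0) :
    fderiv ℝ H ξ ξ = H ξ := by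
  have h1 : HasDerivAt (fun t : ℝ => H (t • ξ)) (fderiv ℝ H ξ ξ) 1 := by
    have h2 : HasDerivAt (fun t : ℝ => t • ξ) ξ 1 := by
      simpa using (hasDerivAt_id (1 : ℝ)).smul_const ξ
    refine HasFDerivAt.comp_hasDerivAt (f := fun t : ℝ => t • ξ) (1 : ℝ) ?_ h2
    simpa using (hH.differentiableAt hξ).hasFDerivAt
  have h3 : HasDerivAt (fun t : ℝ => H (t • ξ)) (H ξ) 1 := by
    have h4 : HasDerivAt (fun t : ℝ => t * H ξ) (H ξ) 1 := by
      simpa using (hasDerivAt_id (1 : ℝ)).mul_const (H ξ)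
    refine h4.congr_of_eventuallyEq ?_
    filter_upwards [lt_mem_nhds (zero_lt_one (α := ℝ))] with t ht
    exact hH.homogeneous ξ hξ t ht
  exact h1.unique h3

/-- The gradient of `H` is `0`-homogeneous, hence its derivative in the radial direction is `0`. -/
theorem fderiv_fderiv_self (hH : IsFinslerNorm H) {ξ : EuclideanSpace ℝ (Fin N)} (hξ : ξ ≠ 0) :
    fderiv ℝ (fderiv ℝ H) ξ ξ = 0 := by
  have h1 : HasDerivAt (fun t : ℝ => fderiv ℝ H (t • ξ)) (fderiv ℝ (fderiv ℝ H) ξ ξ) 1 := by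
    have h2 : HasDerivAt (fun t : ℝ => t • ξ) ξ 1 := by
      simpa using (hasDerivAt_id (1 : ℝ)).smul_const ξ
    refine HasFDerivAt.comp_hasDerivAt (f := fun t : ℝ => t • ξ) (1 : ℝ) ?_ h2
    simpa using (hH.differentiableAt_fderiv hξ).hasFDerivAt
  have h3 : HasDerivAt (fun t : ℝ => fderiv ℝ H (t • ξ)) 0 1 := by
    refine (hasDerivAt_const (1 : ℝ) (fderiv ℝ H ξ)).congr_of_eventuallyEq ?_
    filter_upwards [lt_mem_nhds (zero_lt_one (α := ℝ))] with t ht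
    exact hH.fderiv_smul hξ ht
  exact h1.unique h3

theorem fderiv_fderiv_smul (hH : IsFinslerNorm H) {ξ : EuclideanSpace ℝ (Fin N)} (hξ : ξ ≠ 0)
    {t : ℝ} (ht : 0 < t) :
    t • fderiv ℝ (fderiv ℝ H) (t • ξ) = fderiv ℝ (fderiv ℝ H) ξ := by
  have h1 : (fun η => fderiv ℝ H (t • η)) =ᶠ[𝓝 ξ] fderiv ℝ H := by
    filter_upwards [isOpen_compl_singleton.mem_nhds hξ] with η hη
    exact hH.fderiv_smul hη ht
  rw [← h1.fderiv_eq (𝕜 := ℝ), fderiv_comp_smul]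

theorem mem_frontier (hH : IsFinslerNorm H) {ξ : EuclideanSpace ℝ (Fin N)} (hξ : ξ ≠ 0)
    (h1 : H ξ = 1) : ξ ∈ frontier {η | H η < 1} := by
  have hc : Tendsto (fun t : ℝ => t • ξ) (𝓝 1) (𝓝 ξ) := by
    have : Continuous (fun t : ℝ => t • ξ) := by fun_prop
    simpa using this.tendsto 1
  refine ⟨?_, fun hi => ?_⟩
  · refine mem_closure_of_tendsto (hc.mono_left (nhdsWithin_le_nhds (s := Iio 1))) ?_
    filter_upwards [self_mem_nhdsWithin,
      nhdsWithin_le_nhds (lt_mem_nhds (zero_lt_one (α := ℝ)))] with t ht ht0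
    rw [hH.homogeneous ξ hξ t ht0, h1, mul_one]
    exact ht
  · have h2 := (hc.mono_left (nhdsWithin_le_nhds (s := Ioi 1))).eventually
      (mem_interior_iff_mem_nhds.1 hi)
    obtain ⟨t, ht, ht1⟩ := (h2.and self_mem_nhdsWithin).exists
    change H (t • ξ) < 1 at ht
    change 1 < t at ht1
    rw [hH.homogeneous ξ hξ t (by linarith), h1] at ht
    linarith

/-- Ellipticity concerns the tangential directions on the unit sphere of `H`; by homogeneity the
radial direction is in the kernel of the Hessian, so that the latter is nonnegative everywhere. -/
theorem fderiv_fderiv_nonneg (hH : IsFinslerNorm H) {ξ : EuclideanSpace ℝ (Fin N)} (hξ : ξ ≠ 0)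
    (ζ : EuclideanSpace ℝ (Fin N)) : 0 ≤ fderiv ℝ (fderiv ℝ H) ξ ζ ζ := by
  obtain ⟨lam, hlam, hell⟩ := hH.elliptic
  have hpos := hH.pos ξ hξ
  have ht : 0 < (H ξ)⁻¹ := inv_pos.2 hpos
  rw [← hH.fderiv_fderiv_smul hξ ht]
  set η := (H ξ)⁻¹ • ξ with hη
  have hη0 : η ≠ 0 := smul_ne_zero ht.ne' hξ
  have hη1 : H η = 1 := by
    rw [hη, hH.homogeneous ξ hξ _ ht, inv_mul_cancel₀ hpos.ne']
  set c := fderiv ℝ H η ζ with hc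
  have h1 := hell η (hH.mem_frontier hη0 hη1) (ζ - c • η) (by
    rw [inner_gradient_left, map_sub, map_smul, hH.fderiv_self hη0, hη1]
    simp [hc])
  have h2 : fderiv ℝ (fderiv ℝ H) η ζ η = 0 := by
    have := (hH.contDiffAt hη0).isSymmSndFDerivAt (by simp) ζ η
    rw [this, hH.fderiv_fderiv_self hη0]
    rfl
  simp only [map_sub, map_smul, hH.fderiv_fderiv_self hη0, h2, smul_zero, sub_zero,
    smul_apply, smul_eq_mul] at h1 ⊢
  have : 0 ≤ lam * ‖ζ - c • η‖ ^ 2 := by positivity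
  exact mul_nonneg ht.le (by linarith)

/-- Convexity of `H`, in the form `∇H(ζ) · ξ ≤ H(ξ)`. -/
theorem fderiv_apply_le (hH : IsFinslerNorm H) {ζ ξ : EuclideanSpace ℝ (Fin N)} (hζ : ζ ≠ 0)
    (hξ : ξ ≠ 0) : fderiv ℝ H ζ ξ ≤ H ξ := by
  -- `H` may be singular at the origin, so segments through it are treated separately: there `ξ` is a
  -- nonpositive multiple of `ζ`. On other segments `H` has a nonnegative second derivative.
  by_cases h0 : ∃ s ∈ Icc (0 : ℝ) 1, ζ + s • (ξ - ζ) = 0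
  · obtain ⟨s, ⟨hs0, hs1⟩, hs⟩ := h0
    have hs0' : 0 < s := by
      rcases hs0.eq_or_lt with h | h
      · rw [← h] at hs; simp [hζ] at hs
      · exact h
    have hsx : s • ξ = -((1 - s) • ζ) := by
      rw [eq_neg_iff_add_eq_zero, ← hs]
      module
    have h1 : s * fderiv ℝ H ζ ξ = -((1 - s) * H ζ) := by
      have := congrArg (fderiv ℝ H ζ) hsx
      simpa [hH.fderiv_self hζ] using this
    have h2 : fderiv ℝ H ζ ξ ≤ 0 := by
      have h3 : 0 ≤ (1 - s) * H ζ := mul_nonneg (by linarith) (hH.pos ζ hζ).le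
      by_contra hcon
      push Not at hcon
      have := mul_pos hs0' hcon
      linarith
    exact h2.trans (hH.pos ξ hξ).le
  · push Not at h0
    set γ : ℝ → EuclideanSpace ℝ (Fin N) := fun s => ζ + s • (ξ - ζ) with hγ
    have hγd : ∀ s, HasDerivAt γ (ξ - ζ) s := fun s => by
      have h := ((hasDerivAt_id s).smul_const (ξ - ζ)).const_add ζ
      rw [one_smul] at h
      exact h
    have hf : ∀ s ∈ Icc (0 : ℝ) 1,
        HasDerivAt (fun s => H (γ s)) (fderiv ℝ H (γ s) (ξ - ζ)) s := fun s hs =>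
      (hH.differentiableAt (h0 s hs)).hasFDerivAt.comp_hasDerivAt s (hγd s)
    have hf' : ∀ s ∈ Icc (0 : ℝ) 1, HasDerivAt (fun s => fderiv ℝ H (γ s) (ξ - ζ))
        (fderiv ℝ (fderiv ℝ H) (γ s) (ξ - ζ) (ξ - ζ)) s := fun s hs => by
      have := (hH.differentiableAt_fderiv (h0 s hs)).hasFDerivAt.comp_hasDerivAt s (hγd s)
      simpa using this.clm_apply (hasDerivAt_const s (ξ - ζ))
    obtain ⟨c, hc, hc'⟩ := exists_hasDerivAt_eq_slope (fun s => H (γ s))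
      (fun s => fderiv ℝ H (γ s) (ξ - ζ)) zero_lt_one
      (fun s hs => (hf s hs).continuousAt.continuousWithinAt)
      (fun s hs => hf s (Ioo_subset_Icc_self hs))
    have hsub : Icc 0 c ⊆ Icc (0 : ℝ) 1 := Icc_subset_Icc_right hc.2.le
    obtain ⟨d, hd, hd'⟩ := exists_hasDerivAt_eq_slope (fun s => fderiv ℝ H (γ s) (ξ - ζ))
      (fun s => fderiv ℝ (fderiv ℝ H) (γ s) (ξ - ζ) (ξ - ζ)) hc.1
      (fun s hs => (hf' s (hsub hs)).continuousAt.continuousWithinAt)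
      (fun s hs => hf' s (hsub (Ioo_subset_Icc_self hs)))
    have hnn := hH.fderiv_fderiv_nonneg (h0 d (hsub (Ioo_subset_Icc_self hd))) (ξ - ζ)
    change fderiv ℝ (fderiv ℝ H) (γ d) (ξ - ζ) (ξ - ζ) = _ at hd'
    change 0 ≤ fderiv ℝ (fderiv ℝ H) (γ d) (ξ - ζ) (ξ - ζ) at hnn
    rw [hd', sub_zero, le_div_iff₀ hc.1, zero_mul, sub_nonneg] at hnn
    have g0 : γ 0 = ζ := by simp [hγ]
    have g1 : γ 1 = ξ := by simp [hγ]
    rw [hc', g0, g1, map_sub, hH.fderiv_self hζ] at hnn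
    linarith

end IsFinslerNorm

section Flux

variable {N : ℕ} {H : EuclideanSpace ℝ (Fin N) → ℝ} {p : ℝ}

theorem inner_finslerFlux (H : EuclideanSpace ℝ (Fin N) → ℝ) (p : ℝ)
    (ξ ζ : EuclideanSpace ℝ (Fin N)) :
    inner ℝ (finslerFlux H p ξ) ζ = H ξ ^ (p - 1) * fderiv ℝ H ξ ζ := by
  rw [finslerFlux, real_inner_smul_left, inner_gradient_left]

theorem inner_finslerFlux_self (hH : IsFinslerNorm H) {ξ : EuclideanSpace ℝ (Fin N)}
    (hξ : ξ ≠ 0) : inner ℝ (finslerFlux H p ξ) ξ = H ξ ^ p := by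
  rw [inner_finslerFlux, hH.fderiv_self hξ, Real.rpow_sub_one (hH.pos ξ hξ).ne',
    div_mul_cancel₀ _ (hH.pos ξ hξ).ne']

theorem inner_finslerFlux_self_nonneg (hH : IsFinslerNorm H) (ξ : EuclideanSpace ℝ (Fin N)) :
    0 ≤ inner ℝ (finslerFlux H p ξ) ξ := by
  by_cases hξ : ξ = 0
  · simp [hξ]
  · rw [inner_finslerFlux_self hH hξ]
    exact Real.rpow_nonneg (hH.pos ξ hξ).le _

theorem finslerFlux_smul (hH : IsFinslerNorm H) (ξ : EuclideanSpace ℝ (Fin N)) {t : ℝ}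
    (ht : 0 < t) : finslerFlux H p (t • ξ) = t ^ (p - 1) • finslerFlux H p ξ := by
  by_cases hξ : ξ = 0
  · simp [hξ, finslerFlux_zero hH]
  · rw [finslerFlux, finslerFlux, gradient, gradient, hH.fderiv_smul hξ ht,
      hH.homogeneous ξ hξ t ht, Real.mul_rpow ht.le (hH.pos ξ hξ).le, mul_smul]

/-- Picone's inequality in pointwise form: it combines `∇H(ζ) · ξ ≤ H(ξ)` with Young's inequality,
and expresses the convexity of `H ^ p`. -/
theorem inner_finslerFlux_le (hH : IsFinslerNorm H) (hp : 1 < p)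
    (ζ ξ : EuclideanSpace ℝ (Fin N)) :
    p * inner ℝ (finslerFlux H p ζ) ξ ≤
      inner ℝ (finslerFlux H p ξ) ξ + (p - 1) * inner ℝ (finslerFlux H p ζ) ζ := by
  have h1 := inner_finslerFlux_self_nonneg (p := p) hH ξ
  have h2 := inner_finslerFlux_self_nonneg (p := p) hH ζ
  by_cases hζ : ζ = 0
  · simpa [hζ, finslerFlux_zero hH] using h1
  by_cases hξ : ξ = 0
  · simpa [hξ] using mul_nonneg (by linarith : 0 ≤ p - 1) h2
  rw [inner_finslerFlux_self hH hζ, inner_finslerFlux_self hH hξ, inner_finslerFlux]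
  have hZ := (hH.pos ζ hζ).le
  have hX := (hH.pos ξ hξ).le
  have h3 : H ζ ^ (p - 1) * fderiv ℝ H ζ ξ ≤ H ξ * H ζ ^ (p - 1) := by
    rw [mul_comm]
    exact mul_le_mul_of_nonneg_right (hH.fderiv_apply_le hζ hξ) (Real.rpow_nonneg hZ _)
  have h4 := Real.young_inequality_of_nonneg hX (Real.rpow_nonneg hZ (p - 1))
    (Real.HolderConjugate.conjExponent hp)
  have h5 : (H ζ ^ (p - 1)) ^ p.conjExponent = H ζ ^ p := by
    rw [← Real.rpow_mul hZ, Real.conjExponent]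
    congr 1
    field_simp [(sub_pos.2 hp).ne']
  rw [h5, Real.conjExponent] at h4
  have hp0 : 0 < p := by linarith
  have h6 : p * (H ξ ^ p / p + H ζ ^ p / (p / (p - 1))) = H ξ ^ p + (p - 1) * H ζ ^ p := by
    field_simp
  rw [← h6]
  exact mul_le_mul_of_nonneg_left (h3.trans h4) hp0.le

theorem continuousOn_finslerFlux (hH : IsFinslerNorm H) (p : ℝ) :
    ContinuousOn (finslerFlux H p) {0}ᶜ := by
  intro ξ hξ
  refine ContinuousAt.continuousWithinAt ?_
  refine ContinuousAt.smul (f := fun ξ => H ξ ^ (p - 1)) (g := gradient H) ?_ ?_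
  · exact (hH.contDiffAt hξ).continuousAt.rpow_const (Or.inl (hH.pos ξ hξ).ne')
  · exact (InnerProductSpace.toDual ℝ _).symm.continuous.continuousAt.comp
      (hH.differentiableAt_fderiv hξ).continuousAt

theorem measurable_finslerFlux (hH : IsFinslerNorm H) (p : ℝ) : Measurable (finslerFlux H p) :=
  measurable_of_continuousOn_compl_singleton 0 (continuousOn_finslerFlux hH p)

theorem exists_norm_finslerFlux_le (hH : IsFinslerNorm H) (p : ℝ) :
    ∃ C : ℝ, 0 ≤ C ∧ ∀ ξ, ‖finslerFlux H p ξ‖ ≤ C * ‖ξ‖ ^ (p - 1) := by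
  obtain ⟨C, hC⟩ := (isCompact_sphere (0 : EuclideanSpace ℝ (Fin N)) 1).exists_bound_of_continuousOn
    ((continuousOn_finslerFlux hH p).mono fun ξ hξ => by
      rintro rfl
      simp at hξ)
  refine ⟨max C 0, le_max_right _ _, fun ξ => ?_⟩
  by_cases hξ : ξ = 0
  · rw [hξ, finslerFlux_zero hH, norm_zero]
    positivity
  have hn : 0 < ‖ξ‖ := norm_pos_iff.2 hξ
  have h1 : ξ = ‖ξ‖ • (‖ξ‖⁻¹ • ξ) := by
    rw [smul_smul, mul_inv_cancel₀ hn.ne', one_smul]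
  have h2 : ‖finslerFlux H p ξ‖ = ‖ξ‖ ^ (p - 1) * ‖finslerFlux H p (‖ξ‖⁻¹ • ξ)‖ := by
    conv_lhs => rw [h1, finslerFlux_smul hH _ hn, norm_smul,
      Real.norm_of_nonneg (Real.rpow_nonneg hn.le _)]
  rw [h2, mul_comm]
  refine mul_le_mul_of_nonneg_right ((hC _ ?_).trans (le_max_left _ _)) (Real.rpow_nonneg hn.le _)
  simp [norm_smul, hn.ne']

end Flux

/-! ### Limits of integrals and convergence in `L^q` -/

section Limits

variable {α : Type*} {m : MeasurableSpace α} {μ : Measure α}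

/-- Fatou's lemma for the Bochner integral of nonnegative real functions. -/
theorem integrable_and_integral_le_of_tendsto {f : ℕ → α → ℝ} {F : α → ℝ} {L : ℝ}
    (hf : ∀ n, Integrable (f n) μ) (hf0 : ∀ n, 0 ≤ᵐ[μ] f n)
    (hlim : ∀ᵐ x ∂μ, Tendsto (fun n => f n x) atTop (𝓝 (F x)))
    (hL : Tendsto (fun n => ∫ x, f n x ∂μ) atTop (𝓝 L)) :
    Integrable F μ ∧ ∫ x, F x ∂μ ≤ L := by
  have hFm : AEStronglyMeasurable F μ :=
    aestronglyMeasurable_of_tendsto_ae atTop (fun n => (hf n).1) hlim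
  have hF0 : 0 ≤ᵐ[μ] F := by
    filter_upwards [hlim, ae_all_iff.2 hf0] with x hx h0
    exact ge_of_tendsto' hx h0
  have h1 : ∫⁻ x, ENNReal.ofReal (F x) ∂μ ≤ ENNReal.ofReal L := by
    calc ∫⁻ x, ENNReal.ofReal (F x) ∂μ
        = ∫⁻ x, liminf (fun n => ENNReal.ofReal (f n x)) atTop ∂μ := by
          refine lintegral_congr_ae ?_
          filter_upwards [hlim] with x hx
          exact ((ENNReal.continuous_ofReal.tendsto _).comp hx).liminf_eq.symm
      _ ≤ liminf (fun n => ∫⁻ x, ENNReal.ofReal (f n x) ∂μ) atTop :=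
          lintegral_liminf_le' fun n => (hf n).1.aemeasurable.ennreal_ofReal
      _ = liminf (fun n => ENNReal.ofReal (∫ x, f n x ∂μ)) atTop := by
          congr 1
          funext n
          exact (ofReal_integral_eq_lintegral_ofReal (hf n) (hf0 n)).symm
      _ = ENNReal.ofReal L := ((ENNReal.continuous_ofReal.tendsto _).comp hL).liminf_eq
  have hFi : Integrable F μ := by
    refine ⟨hFm, ?_⟩
    rw [hasFiniteIntegral_iff_ofReal hF0]
    exact h1.trans_lt ENNReal.ofReal_lt_top
  refine ⟨hFi, ?_⟩
  rw [← ofReal_integral_eq_lintegral_ofReal hFi hF0] at h1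
  have hL0 : 0 ≤ L := ge_of_tendsto' hL fun n => integral_nonneg_of_ae (hf0 n)
  exact (ENNReal.ofReal_le_ofReal_iff hL0).1 h1

variable {E : Type*} [NormedAddCommGroup E]

theorem tendsto_eLpNorm_add_sub {q : ENNReal} (hq : 1 ≤ q) {f g : ℕ → α → E} {F G : α → E}
    (hf : ∀ n, AEStronglyMeasurable (f n) μ) (hg : ∀ n, AEStronglyMeasurable (g n) μ)
    (hF : AEStronglyMeasurable F μ) (hG : AEStronglyMeasurable G μ)
    (hfF : Tendsto (fun n => eLpNorm (fun x => f n x - F x) q μ) atTop (𝓝 0))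
    (hgG : Tendsto (fun n => eLpNorm (fun x => g n x - G x) q μ) atTop (𝓝 0)) :
    Tendsto (fun n => eLpNorm (fun x => f n x + g n x - (F x + G x)) q μ) atTop (𝓝 0) := by
  have h0 := hfF.add hgG
  rw [add_zero] at h0
  refine tendsto_of_tendsto_of_tendsto_of_le_of_le tendsto_const_nhds h0
    (fun _ => bot_le) fun n => ?_
  have : (fun x => f n x + g n x - (F x + G x)) =
      (fun x => f n x - F x) + fun x => g n x - G x := by
    funext x
    simp only [Pi.add_apply]
    abel
  rw [this]
  exact eLpNorm_add_le ((hf n).sub hF) ((hg n).sub hG) hq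

variable [NormedSpace ℝ E]

/-- The product of a bounded sequence of scalar functions converging almost everywhere and a
sequence converging in `L^q` converges in `L^q`. -/
theorem tendsto_eLpNorm_smul_sub {q : ENNReal} (hq : 1 ≤ q) (hq' : q ≠ ⊤) {c : ℕ → α → ℝ}
    {d : α → ℝ} {W : ℕ → α → E} {V : α → E} {C : ℝ}
    (hc : ∀ n, AEStronglyMeasurable (c n) μ) (hcb : ∀ n, ∀ᵐ x ∂μ, |c n x| ≤ C)
    (hcd : ∀ᵐ x ∂μ, Tendsto (fun n => c n x) atTop (𝓝 (d x)))
    (hW : ∀ n, AEStronglyMeasurable (W n) μ) (hV : MemLp V q μ)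
    (hWV : Tendsto (fun n => eLpNorm (fun x => W n x - V x) q μ) atTop (𝓝 0)) :
    Tendsto (fun n => eLpNorm (fun x => c n x • W n x - d x • V x) q μ) atTop (𝓝 0) := by
  have hq0 : q ≠ 0 := (zero_lt_one.trans_le hq).ne'
  have hqr : 0 < q.toReal := ENNReal.toReal_pos hq0 hq'
  have hd : AEStronglyMeasurable d μ := aestronglyMeasurable_of_tendsto_ae atTop hc hcd
  have hdb : ∀ᵐ x ∂μ, |d x| ≤ C := by
    filter_upwards [hcd, ae_all_iff.2 hcb] with x hx hb
    exact le_of_tendsto' hx.abs hb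
  have h1 : Tendsto (fun n => eLpNorm (fun x => c n x • (W n x - V x)) q μ) atTop (𝓝 0) := by
    have h0 : Tendsto (fun n => ENNReal.ofReal C * eLpNorm (fun x => W n x - V x) q μ) atTop
        (𝓝 0) := by
      simpa using ENNReal.Tendsto.const_mul hWV (Or.inr ENNReal.ofReal_ne_top)
    refine tendsto_of_tendsto_of_tendsto_of_le_of_le tendsto_const_nhds h0
      (fun _ => bot_le) fun n => ?_
    refine eLpNorm_le_mul_eLpNorm_of_ae_le_mul ?_ q
    filter_upwards [hcb n] with x hx
    rw [norm_smul]
    exact mul_le_mul_of_nonneg_right hx (norm_nonneg _)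
  have h2 : Tendsto (fun n => eLpNorm (fun x => (c n x - d x) • V x) q μ) atTop (𝓝 0) := by
    simp_rw [eLpNorm_eq_lintegral_rpow_enorm_toReal hq0 hq']
    have h3 : Tendsto (fun n => ∫⁻ x, ‖(c n x - d x) • V x‖ₑ ^ q.toReal ∂μ) atTop
        (𝓝 (∫⁻ _, 0 ∂μ)) := by
      refine tendsto_lintegral_of_dominated_convergence'
        (fun x => ‖(2 * C) • V x‖ₑ ^ q.toReal) (fun n => ?_) (fun n => ?_) ?_ ?_
      · exact ((((hc n).sub hd).smul hV.1).enorm).pow_const _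
      · filter_upwards [hcb n, hdb] with x hx hx'
        refine ENNReal.rpow_le_rpow ?_ hqr.le
        rw [enorm_smul, enorm_smul]
        refine mul_le_mul_left (enorm_le_iff_norm_le.2 ?_) _
        rw [Real.norm_eq_abs, Real.norm_eq_abs]
        refine le_trans ?_ (le_abs_self _)
        have := abs_sub (c n x) (d x)
        linarith
      · exact (lintegral_rpow_enorm_lt_top_of_eLpNorm_lt_top hq0 hq'
          (hV.const_smul (2 * C)).2).ne
      · filter_upwards [hcd] with x hx
        have h4 : Tendsto (fun n => (c n x - d x) • V x) atTop (𝓝 0) := by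
          simpa using (hx.sub_const (d x)).smul_const (V x)
        have h5 := (ENNReal.continuous_rpow_const (y := q.toReal)).tendsto 0
        rw [ENNReal.zero_rpow_of_pos hqr] at h5
        refine h5.comp ?_
        have h6 := (continuous_enorm.tendsto (0 : E)).comp h4
        rw [enorm_zero] at h6
        exact h6
    rw [lintegral_zero] at h3
    have h6 := (ENNReal.continuous_rpow_const (y := 1 / q.toReal)).tendsto 0
    rw [ENNReal.zero_rpow_of_pos (by positivity)] at h6
    exact h6.comp h3
  have h7 := tendsto_eLpNorm_add_sub hq (μ := μ) (f := fun n x => c n x • (W n x - V x))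
    (g := fun n x => (c n x - d x) • V x) (F := fun _ => 0) (G := fun _ => 0)
    (fun n => (hc n).smul ((hW n).sub hV.1)) (fun n => ((hc n).sub hd).smul hV.1)
    aestronglyMeasurable_const aestronglyMeasurable_const (by simpa using h1) (by simpa using h2)
  refine h7.congr fun n => ?_
  congr 1
  funext x
  rw [smul_sub, sub_smul]
  abel_nf

end Limits

section Duality

variable {α : Type*} {m : MeasurableSpace α} {μ : Measure α} {E : Type*} [NormedAddCommGroup E]
  [InnerProductSpace ℝ E] {q r : ENNReal} [r.HolderTriple q 1]

theorem MeasureTheory.MemLp.integrable_inner_of_holder {B W : α → E} (hB : MemLp B r μ)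
    (hW : MemLp W q μ) : Integrable (fun x => inner ℝ (B x) (W x)) μ := by
  rw [← memLp_one_iff_integrable]
  refine MemLp.of_bilin (fun b w : E => inner ℝ b w) 1 hB hW (hB.1.inner hW.1) ?_
  refine ae_of_all _ fun x => ?_
  rw [one_mul]
  exact nnnorm_inner_le_nnnorm _ _

theorem tendsto_integral_inner {B W : α → E} {V : ℕ → α → E} (hB : MemLp B r μ)
    (hW : MemLp W q μ) (hV : ∀ n, MemLp (V n) q μ)
    (hlim : Tendsto (fun n => eLpNorm (fun x => V n x - W x) q μ) atTop (𝓝 0)) :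
    Tendsto (fun n => ∫ x, inner ℝ (B x) (V n x) ∂μ) atTop (𝓝 (∫ x, inner ℝ (B x) (W x) ∂μ)) := by
  refine tendsto_integral_of_L1' _ (hB.integrable_inner_of_holder hW).1
    (Eventually.of_forall fun n => hB.integrable_inner_of_holder (hV n)) ?_
  have h0 : Tendsto (fun n => eLpNorm B r μ * eLpNorm (fun x => V n x - W x) q μ) atTop
      (𝓝 0) := by
    simpa using ENNReal.Tendsto.const_mul hlim (Or.inr hB.2.ne)
  refine tendsto_of_tendsto_of_tendsto_of_le_of_le tendsto_const_nhds h0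
    (fun _ => bot_le) fun n => ?_
  have h1 := eLpNorm_le_eLpNorm_mul_eLpNorm_of_nnnorm (p := r) (q := q) (r := 1) hB.1
    ((hV n).1.sub hW.1) (fun b w : E => inner ℝ b w) 1
    (ae_of_all _ fun x => by rw [one_mul]; exact nnnorm_inner_le_nnnorm _ _)
  rw [ENNReal.coe_one, one_mul] at h1
  refine le_trans (le_of_eq ?_) h1
  congr 1
  funext x
  simp [inner_sub_right]

end Duality

/-! ### Limits of nonnegative test functions -/

section TestLimit

variable {N : ℕ} {Ω : Set (EuclideanSpace ℝ (Fin N))} {p : ℝ}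

theorem IsTestFun.continuous_gradient {φ : EuclideanSpace ℝ (Fin N) → ℝ}
    (hφ : IsTestFun 1 Ω φ) : Continuous (gradient φ) :=
  (InnerProductSpace.toDual ℝ _).symm.continuous.comp
    ((show ContDiff ℝ 1 φ from hφ.contDiff).continuous_fderiv (by norm_num))

theorem IsTestFun.hasCompactSupport_gradient {φ : EuclideanSpace ℝ (Fin N) → ℝ}
    (hφ : IsTestFun 1 Ω φ) : HasCompactSupport (gradient φ) :=
  (hφ.hasCompactSupport.fderiv (𝕜 := ℝ)).comp_left (map_zero _)

theorem IsTestFun.memLp_gradient {φ : EuclideanSpace ℝ (Fin N) → ℝ}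
    (hφ : IsTestFun 1 Ω φ) (q : ENNReal) : MemLp (gradient φ) q (volume.restrict Ω) :=
  (hφ.continuous_gradient.memLp_of_hasCompactSupport hφ.hasCompactSupport_gradient).restrict Ω

/-- The nonnegative test functions `φ n` of class `C¹_c(Ω)` converge to `w` almost everywhere in
`Ω`, and their gradients converge to `W` in `L^p(Ω)`. This replaces membership of the nonnegative
function `w` in `W^{1,p}_0(Ω)`; neither `w ∈ L^p` nor weak derivatives are needed. -/
structure IsTestLimit (p : ℝ) (Ω : Set (EuclideanSpace ℝ (Fin N)))
    (φ : ℕ → EuclideanSpace ℝ (Fin N) → ℝ) (w : EuclideanSpace ℝ (Fin N) → ℝ)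
    (W : EuclideanSpace ℝ (Fin N) → EuclideanSpace ℝ (Fin N)) : Prop where
  isTestFun : ∀ n, IsTestFun 1 Ω (φ n)
  nonneg : ∀ n x, 0 ≤ φ n x
  memLp : MemLp W (ENNReal.ofReal p) (volume.restrict Ω)
  tendsto_ae : ∀ᵐ x ∂(volume.restrict Ω), Tendsto (fun n => φ n x) atTop (𝓝 (w x))
  tendsto_gradient : Tendsto (fun n => eLpNorm (fun x => gradient (φ n) x - W x)
    (ENNReal.ofReal p) (volume.restrict Ω)) atTop (𝓝 0)

theorem IsTestLimit.ae_nonneg {φ : ℕ → EuclideanSpace ℝ (Fin N) → ℝ}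
    {w : EuclideanSpace ℝ (Fin N) → ℝ} {W : EuclideanSpace ℝ (Fin N) → EuclideanSpace ℝ (Fin N)}
    (h : IsTestLimit p Ω φ w W) : ∀ᵐ x ∂(volume.restrict Ω), 0 ≤ w x := by
  filter_upwards [h.tendsto_ae] with x hx
  exact ge_of_tendsto' hx fun n => h.nonneg n x

theorem IsTestLimit.aestronglyMeasurable {φ : ℕ → EuclideanSpace ℝ (Fin N) → ℝ}
    {w : EuclideanSpace ℝ (Fin N) → ℝ} {W : EuclideanSpace ℝ (Fin N) → EuclideanSpace ℝ (Fin N)}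
    (h : IsTestLimit p Ω φ w W) : AEStronglyMeasurable w (volume.restrict Ω) :=
  aestronglyMeasurable_of_tendsto_ae atTop
    (fun n => (h.isTestFun n).contDiff.continuous.aestronglyMeasurable) h.tendsto_ae

theorem IsTestFun.isTestLimit {φ : EuclideanSpace ℝ (Fin N) → ℝ} (hφ : IsTestFun 1 Ω φ)
    (h0 : ∀ x, 0 ≤ φ x) : IsTestLimit p Ω (fun _ => φ) φ (gradient φ) where
  isTestFun _ := hφ
  nonneg _ := h0
  memLp := hφ.memLp_gradient _
  tendsto_ae := ae_of_all _ fun _ => tendsto_const_nhds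
  tendsto_gradient := by simp

/-- `f` is nonnegative and of class `C¹` near the closed first quadrant, vanishes at the origin, and
has partial derivatives `f₁` and `f₂`, which are bounded in the quadrant. -/
structure IsQuadrantC1 (f f₁ f₂ : ℝ × ℝ → ℝ) (C : ℝ) : Prop where
  map_zero : f 0 = 0
  nonneg : ∀ z : ℝ × ℝ, 0 ≤ z.1 → 0 ≤ z.2 → 0 ≤ f z
  contDiffAt : ∀ z : ℝ × ℝ, 0 ≤ z.1 → 0 ≤ z.2 → ContDiffAt ℝ 1 f z
  hasFDerivAt : ∀ z : ℝ × ℝ, 0 ≤ z.1 → 0 ≤ z.2 → HasFDerivAt f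
    (f₁ z • ContinuousLinearMap.fst ℝ ℝ ℝ + f₂ z • ContinuousLinearMap.snd ℝ ℝ ℝ) z
  abs_le₁ : ∀ z : ℝ × ℝ, 0 ≤ z.1 → 0 ≤ z.2 → |f₁ z| ≤ C
  abs_le₂ : ∀ z : ℝ × ℝ, 0 ≤ z.1 → 0 ≤ z.2 → |f₂ z| ≤ C

namespace IsQuadrantC1

variable {f f₁ f₂ : ℝ × ℝ → ℝ} {C : ℝ}

theorem fderiv_apply_fst (hf : IsQuadrantC1 f f₁ f₂ C) {z : ℝ × ℝ} (h1 : 0 ≤ z.1) (h2 : 0 ≤ z.2) :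
    fderiv ℝ f z (1, 0) = f₁ z := by
  simp [(hf.hasFDerivAt z h1 h2).fderiv]

theorem fderiv_apply_snd (hf : IsQuadrantC1 f f₁ f₂ C) {z : ℝ × ℝ} (h1 : 0 ≤ z.1) (h2 : 0 ≤ z.2) :
    fderiv ℝ f z (0, 1) = f₂ z := by
  simp [(hf.hasFDerivAt z h1 h2).fderiv]

theorem continuousAt_fderiv (hf : IsQuadrantC1 f f₁ f₂ C) {z : ℝ × ℝ} (h1 : 0 ≤ z.1)
    (h2 : 0 ≤ z.2) : ContinuousAt (fderiv ℝ f) z :=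
  ((hf.contDiffAt z h1 h2).fderiv_right (m := 0) (by norm_num)).continuousAt

/-- The chain rule for test functions. -/
theorem gradient_comp (hf : IsQuadrantC1 f f₁ f₂ C) {φ ψ : EuclideanSpace ℝ (Fin N) → ℝ}
    (hφ : IsTestFun 1 Ω φ) (hψ : IsTestFun 1 Ω ψ) (hφ0 : ∀ x, 0 ≤ φ x) (hψ0 : ∀ x, 0 ≤ ψ x)
    (x : EuclideanSpace ℝ (Fin N)) : gradient (fun x => f (φ x, ψ x)) x =
      f₁ (φ x, ψ x) • gradient φ x + f₂ (φ x, ψ x) • gradient ψ x := by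
  have h1 : HasFDerivAt φ (fderiv ℝ φ x) x :=
    ((show ContDiff ℝ 1 φ from hφ.contDiff).differentiable (by norm_num) x).hasFDerivAt
  have h2 : HasFDerivAt ψ (fderiv ℝ ψ x) x :=
    ((show ContDiff ℝ 1 ψ from hψ.contDiff).differentiable (by norm_num) x).hasFDerivAt
  have h3 := (hf.hasFDerivAt (φ x, ψ x) (hφ0 x) (hψ0 x)).comp x (h1.prodMk h2)
  refine ext_inner_right ℝ fun e => ?_
  rw [inner_add_left, real_inner_smul_left, real_inner_smul_left, inner_gradient_left,
    inner_gradient_left, inner_gradient_left]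
  change fderiv ℝ (f ∘ fun x => (φ x, ψ x)) x e = _
  rw [h3.fderiv]
  simp

theorem isTestFun_comp (hf : IsQuadrantC1 f f₁ f₂ C) {φ ψ : EuclideanSpace ℝ (Fin N) → ℝ}
    (hφ : IsTestFun 1 Ω φ) (hψ : IsTestFun 1 Ω ψ) (hφ0 : ∀ x, 0 ≤ φ x) (hψ0 : ∀ x, 0 ≤ ψ x) :
    IsTestFun 1 Ω (fun x => f (φ x, ψ x)) := by
  have hsub : tsupport (fun x => f (φ x, ψ x)) ⊆ tsupport φ ∪ tsupport ψ := by
    refine closure_minimal (fun x hx => ?_) ((isClosed_tsupport φ).union (isClosed_tsupport ψ))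
    by_contra hcon
    rw [mem_union, not_or] at hcon
    refine hx ?_
    change f (φ x, ψ x) = 0
    rw [image_eq_zero_of_notMem_tsupport hcon.1, image_eq_zero_of_notMem_tsupport hcon.2]
    exact hf.map_zero
  refine ⟨?_, ?_, hsub.trans (union_subset hφ.tsupport_subset hψ.tsupport_subset)⟩
  · refine contDiff_iff_contDiffAt.2 fun x => ?_
    exact (hf.contDiffAt (φ x, ψ x) (hφ0 x) (hψ0 x)).comp x
      ((show ContDiff ℝ 1 φ from hφ.contDiff).contDiffAt.prodMk
        (show ContDiff ℝ 1 ψ from hψ.contDiff).contDiffAt)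
  · exact (hφ.hasCompactSupport.isCompact.union hψ.hasCompactSupport.isCompact).of_isClosed_subset
      (isClosed_tsupport _) hsub

theorem isTestLimit_comp (hf : IsQuadrantC1 f f₁ f₂ C) (hp : 1 ≤ p)
    {φ ψ : ℕ → EuclideanSpace ℝ (Fin N) → ℝ} {u v : EuclideanSpace ℝ (Fin N) → ℝ}
    {U V : EuclideanSpace ℝ (Fin N) → EuclideanSpace ℝ (Fin N)}
    (hu : IsTestLimit p Ω φ u U) (hv : IsTestLimit p Ω ψ v V) :
    IsTestLimit p Ω (fun n x => f (φ n x, ψ n x)) (fun x => f (u x, v x))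
      (fun x => f₁ (u x, v x) • U x + f₂ (u x, v x) • V x) := by
  have hp1 : 1 ≤ ENNReal.ofReal p := ENNReal.one_le_ofReal.2 hp
  have hlim : ∀ᵐ x ∂(volume.restrict Ω),
      Tendsto (fun n => (φ n x, ψ n x)) atTop (𝓝 (u x, v x)) := by
    filter_upwards [hu.tendsto_ae, hv.tendsto_ae] with x hx hx'
    exact hx.prodMk_nhds hx'
  have hcont : ∀ n, Continuous fun x => fderiv ℝ f (φ n x, ψ n x) := fun n =>
    continuous_iff_continuousAt.2 fun x => ContinuousAt.comp (g := fderiv ℝ f)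
      (hf.continuousAt_fderiv (z := (φ n x, ψ n x)) (hu.nonneg n x) (hv.nonneg n x))
      ((hu.isTestFun n).contDiff.continuous.prodMk
        (hv.isTestFun n).contDiff.continuous).continuousAt
  have hm1 : ∀ n, AEStronglyMeasurable (fun x => f₁ (φ n x, ψ n x)) (volume.restrict Ω) := by
    intro n
    refine Continuous.aestronglyMeasurable (((hcont n).clm_apply
      (continuous_const (y := ((1, 0) : ℝ × ℝ)))).congr fun x => ?_)
    exact hf.fderiv_apply_fst (hu.nonneg n x) (hv.nonneg n x)
  have hm2 : ∀ n, AEStronglyMeasurable (fun x => f₂ (φ n x, ψ n x)) (volume.restrict Ω) := by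
    intro n
    refine Continuous.aestronglyMeasurable (((hcont n).clm_apply
      (continuous_const (y := ((0, 1) : ℝ × ℝ)))).congr fun x => ?_)
    exact hf.fderiv_apply_snd (hu.nonneg n x) (hv.nonneg n x)
  have hl1 : ∀ᵐ x ∂(volume.restrict Ω),
      Tendsto (fun n => f₁ (φ n x, ψ n x)) atTop (𝓝 (f₁ (u x, v x))) := by
    filter_upwards [hlim, hu.ae_nonneg, hv.ae_nonneg] with x hx h1 h2
    have h3 := ((ContinuousLinearMap.apply ℝ ℝ ((1, 0) : ℝ × ℝ)).continuous.tendsto _).comp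
      ((hf.continuousAt_fderiv (z := (u x, v x)) h1 h2).tendsto.comp hx)
    rw [ContinuousLinearMap.apply_apply, hf.fderiv_apply_fst (z := (u x, v x)) h1 h2] at h3
    exact h3.congr fun n => hf.fderiv_apply_fst (hu.nonneg n x) (hv.nonneg n x)
  have hl2 : ∀ᵐ x ∂(volume.restrict Ω),
      Tendsto (fun n => f₂ (φ n x, ψ n x)) atTop (𝓝 (f₂ (u x, v x))) := by
    filter_upwards [hlim, hu.ae_nonneg, hv.ae_nonneg] with x hx h1 h2
    have h3 := ((ContinuousLinearMap.apply ℝ ℝ ((0, 1) : ℝ × ℝ)).continuous.tendsto _).comp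
      ((hf.continuousAt_fderiv (z := (u x, v x)) h1 h2).tendsto.comp hx)
    rw [ContinuousLinearMap.apply_apply, hf.fderiv_apply_snd (z := (u x, v x)) h1 h2] at h3
    exact h3.congr fun n => hf.fderiv_apply_snd (hu.nonneg n x) (hv.nonneg n x)
  have hM1 : MemLp (fun x => f₁ (u x, v x) • U x) (ENNReal.ofReal p) (volume.restrict Ω) := by
    refine hu.memLp.of_le_mul (c := C)
      ((aestronglyMeasurable_of_tendsto_ae atTop hm1 hl1).smul hu.memLp.1) ?_
    filter_upwards [hu.ae_nonneg, hv.ae_nonneg] with x h1 h2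
    rw [norm_smul]
    exact mul_le_mul_of_nonneg_right (hf.abs_le₁ (u x, v x) h1 h2) (norm_nonneg _)
  have hM2 : MemLp (fun x => f₂ (u x, v x) • V x) (ENNReal.ofReal p) (volume.restrict Ω) := by
    refine hv.memLp.of_le_mul (c := C)
      ((aestronglyMeasurable_of_tendsto_ae atTop hm2 hl2).smul hv.memLp.1) ?_
    filter_upwards [hu.ae_nonneg, hv.ae_nonneg] with x h1 h2
    rw [norm_smul]
    exact mul_le_mul_of_nonneg_right (hf.abs_le₂ (u x, v x) h1 h2) (norm_nonneg _)
  refine ⟨fun n => hf.isTestFun_comp (hu.isTestFun n) (hv.isTestFun n) (hu.nonneg n) (hv.nonneg n),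
    fun n x => hf.nonneg _ (hu.nonneg n x) (hv.nonneg n x), hM1.add hM2, ?_, ?_⟩
  · filter_upwards [hlim, hu.ae_nonneg, hv.ae_nonneg] with x hx h1 h2
    exact (hf.contDiffAt (u x, v x) h1 h2).continuousAt.tendsto.comp hx
  · have hg1 : ∀ n, AEStronglyMeasurable (gradient (φ n)) (volume.restrict Ω) := fun n =>
      (hu.isTestFun n).continuous_gradient.aestronglyMeasurable
    have hg2 : ∀ n, AEStronglyMeasurable (gradient (ψ n)) (volume.restrict Ω) := fun n =>
      (hv.isTestFun n).continuous_gradient.aestronglyMeasurable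
    refine (tendsto_eLpNorm_add_sub hp1 (fun n => (hm1 n).smul (hg1 n))
      (fun n => (hm2 n).smul (hg2 n)) hM1.1 hM2.1
      (tendsto_eLpNorm_smul_sub hp1 ENNReal.ofReal_ne_top hm1
        (fun n => ae_of_all _ fun x => hf.abs_le₁ _ (hu.nonneg n x) (hv.nonneg n x)) hl1 hg1
        hu.memLp hu.tendsto_gradient)
      (tendsto_eLpNorm_smul_sub hp1 ENNReal.ofReal_ne_top hm2
        (fun n => ae_of_all _ fun x => hf.abs_le₂ _ (hu.nonneg n x) (hv.nonneg n x)) hl2 hg2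
        hv.memLp hv.tendsto_gradient)).congr fun n => ?_
    congr 1
    funext x
    rw [hf.gradient_comp (hu.isTestFun n) (hv.isTestFun n) (hu.nonneg n) (hv.nonneg n)]
    rfl

end IsQuadrantC1

/-- The square of the positive part is of class `C¹`. -/
theorem hasDerivAt_max_zero_sq (s : ℝ) : HasDerivAt (fun s : ℝ => max s 0 ^ 2) (2 * max s 0) s := by
  rcases lt_trichotomy s 0 with h | h | h
  · rw [max_eq_right h.le, mul_zero]
    refine (hasDerivAt_const s (0 : ℝ)).congr_of_eventuallyEq ?_
    filter_upwards [gt_mem_nhds h] with x hx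
    rw [max_eq_right hx.le]
    norm_num
  · subst h
    rw [max_self, mul_zero, hasDerivAt_iff_isLittleO_nhds_zero]
    have h1 : (fun h : ℝ => max (0 + h) 0 ^ 2 - max (0 : ℝ) 0 ^ 2 - h • (0 : ℝ)) =O[𝓝 0]
        fun h => h ^ 2 := by
      refine Asymptotics.IsBigO.of_bound 1 (Eventually.of_forall fun x => ?_)
      rw [zero_add, max_self, smul_zero, sub_zero, one_mul, zero_pow two_ne_zero, sub_zero,
        norm_pow, norm_pow]
      refine pow_le_pow_left₀ (norm_nonneg _) ?_ 2
      rw [Real.norm_eq_abs, Real.norm_eq_abs, abs_of_nonneg (le_max_right _ _)]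
      exact max_le (le_abs_self x) (abs_nonneg x)
    refine h1.trans_isLittleO ?_
    simpa using Asymptotics.isLittleO_pow_pow (𝕜 := ℝ) (one_lt_two)
  · rw [max_eq_left h.le]
    have h1 : HasDerivAt (fun s : ℝ => s ^ 2) (2 * s) s := by
      simpa using hasDerivAt_pow 2 s
    refine h1.congr_of_eventuallyEq ?_
    filter_upwards [lt_mem_nhds h] with x hx
    rw [max_eq_left hx.le]

theorem contDiff_max_zero_sq : ContDiff ℝ 1 (fun s : ℝ => max s 0 ^ 2) := by
  rw [contDiff_one_iff_deriv]
  refine ⟨fun s => (hasDerivAt_max_zero_sq s).differentiableAt, ?_⟩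
  rw [show deriv (fun s : ℝ => max s 0 ^ 2) = fun s => 2 * max s 0 from
    funext fun s => (hasDerivAt_max_zero_sq s).deriv]
  fun_prop

/-- A smooth substitute for the positive part. -/
theorem hasDerivAt_softPos {δ : ℝ} (hδ : 0 < δ) (s : ℝ) :
    HasDerivAt (fun s : ℝ => s * max s 0 ^ 2 / (s ^ 2 + δ))
      (max s 0 ^ 2 * (s ^ 2 + 3 * δ) / (s ^ 2 + δ) ^ 2) s := by
  have h0 : s ^ 2 + δ ≠ 0 := by positivity
  have h1 := ((hasDerivAt_id s).mul (hasDerivAt_max_zero_sq s)).div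
    (((hasDerivAt_id s).pow 2).add_const δ) h0
  refine h1.congr_deriv ?_
  have h2 : s * max s 0 = max s 0 ^ 2 := by
    rcases le_total s 0 with h | h
    · simp [max_eq_right h]
    · rw [max_eq_left h, sq]
  simp only [id, Pi.mul_apply]
  congr 1
  norm_num
  linear_combination (2 * (s ^ 2 + δ)) * h2

/-- A positive function in `W^{1,p}_0(Ω)` is a limit of nonnegative test functions. -/
theorem MemSobolevZero.exists_isTestLimit (hp : 1 ≤ p) {u : EuclideanSpace ℝ (Fin N) → ℝ}
    {U : EuclideanSpace ℝ (Fin N) → EuclideanSpace ℝ (Fin N)} (hu : MemSobolevZero p Ω u U)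
    (hu0 : ∀ᵐ x ∂(volume.restrict Ω), 0 < u x) : ∃ φ, IsTestLimit p Ω φ u U := by
  have hp1 : 1 ≤ ENNReal.ofReal p := ENNReal.one_le_ofReal.2 hp
  have hp0 : ENNReal.ofReal p ≠ 0 := (zero_lt_one.trans_le hp1).ne'
  obtain ⟨φ', hφ', hlim', hgrad'⟩ := hu.exists_approx
  obtain ⟨k, hk, hae⟩ := (tendstoInMeasure_of_tendsto_eLpNorm hp0
    (fun n => (hφ' n).contDiff.continuous.aestronglyMeasurable) hu.memSobolev.memLp.1
    hlim').exists_seq_tendsto_ae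
  set φ := fun n => φ' (k n) with hφdef
  have hφ : ∀ n, IsTestFun 1 Ω (φ n) := fun n =>
    ⟨(hφ' (k n)).contDiff.of_le (by exact_mod_cast le_top), (hφ' (k n)).hasCompactSupport,
      (hφ' (k n)).tsupport_subset⟩
  have hgrad := hgrad'.comp hk.tendsto_atTop
  set δ : ℕ → ℝ := fun n => 1 / ((n : ℝ) + 1) with hδdef
  have hδ : ∀ n, 0 < δ n := fun n => by positivity
  have hδlim : Tendsto δ atTop (𝓝 0) := tendsto_one_div_add_atTop_nhds_zero_nat
  set σ : ℕ → ℝ → ℝ := fun n s => s * max s 0 ^ 2 / (s ^ 2 + δ n) with hσ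
  set σ' : ℕ → ℝ → ℝ := fun n s => max s 0 ^ 2 * (s ^ 2 + 3 * δ n) / (s ^ 2 + δ n) ^ 2 with hσ'
  have hσd : ∀ n s, HasDerivAt (σ n) (σ' n s) s := fun n s => hasDerivAt_softPos (hδ n) s
  have hσc : ∀ n, ContDiff ℝ 1 (σ n) := fun n =>
    (contDiff_id.mul contDiff_max_zero_sq).div (by fun_prop) fun s => by
      have h1 : 0 < s ^ 2 + δ n := add_pos_of_nonneg_of_pos (sq_nonneg s) (hδ n)
      exact h1.ne'
  have hσ'c : ∀ n, Continuous (σ' n) := fun n => by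
    have := (hσc n).continuous_deriv (by norm_num)
    rwa [show deriv (σ n) = σ' n from funext fun s => (hσd n s).deriv] at this
  have hσ'b : ∀ n s, |σ' n s| ≤ 3 := fun n s => by
    have h1 := hδ n
    rw [abs_of_nonneg (by positivity), div_le_iff₀ (by positivity)]
    have h2 : max s 0 ^ 2 ≤ s ^ 2 := by
      rcases le_total s 0 with h | h
      · rw [max_eq_right h, zero_pow two_ne_zero]; positivity
      · rw [max_eq_left h]
    have h3 : max s 0 ^ 2 * (s ^ 2 + 3 * δ n) ≤ s ^ 2 * (s ^ 2 + 3 * δ n) :=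
      mul_le_mul_of_nonneg_right h2 (by positivity)
    nlinarith [mul_nonneg (sq_nonneg s) h1.le, sq_nonneg (δ n), sq_nonneg (s ^ 2)]
  have hgr : ∀ n x, gradient (fun x => σ n (φ n x)) x = σ' n (φ n x) • gradient (φ n) x := by
    intro n x
    have h1 : HasFDerivAt (φ n) (fderiv ℝ (φ n) x) x :=
      ((show ContDiff ℝ 1 (φ n) from (hφ n).contDiff).differentiable (by norm_num) x).hasFDerivAt
    have h3 := (hσd n (φ n x)).comp_hasFDerivAt x h1
    refine ext_inner_right ℝ fun e => ?_
    rw [real_inner_smul_left, inner_gradient_left, inner_gradient_left]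
    change fderiv ℝ (σ n ∘ φ n) x e = _
    rw [h3.fderiv]
    simp
  refine ⟨fun n x => σ n (φ n x), fun n => ?_, fun n x => ?_, hu.memSobolev.memLp_grad, ?_, ?_⟩
  · have hσ0 : σ n 0 = 0 := by simp [hσ]
    refine ⟨(hσc n).comp (show ContDiff ℝ 1 (φ n) from (hφ n).contDiff),
      (hφ n).hasCompactSupport.comp_left hσ0, ?_⟩
    exact (closure_mono (Function.support_comp_subset hσ0 (φ n))).trans (hφ n).tsupport_subset
  · have h1 := hδ n
    refine div_nonneg ?_ (by positivity)
    rcases le_total (φ n x) 0 with h | h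
    · simp [max_eq_right h]
    · positivity
  · filter_upwards [hae, hu0] with x hx h0
    have h1 : Tendsto (fun n => σ n (φ n x)) atTop
        (𝓝 (u x * max (u x) 0 ^ 2 / (u x ^ 2 + 0))) := by
      refine (hx.mul ((hx.max tendsto_const_nhds).pow 2)).div ((hx.pow 2).add hδlim) ?_
      positivity
    rw [max_eq_left h0.le, add_zero, mul_div_cancel_right₀ _ (pow_ne_zero 2 h0.ne')] at h1
    exact h1
  · have h1 := tendsto_eLpNorm_smul_sub (μ := volume.restrict Ω) (c := fun n x => σ' n (φ n x))
      (d := fun _ => 1) (C := 3) hp1 ENNReal.ofReal_ne_top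
      (fun n => ((hσ'c n).comp (hφ n).contDiff.continuous).aestronglyMeasurable)
      (fun n => ae_of_all _ fun x => hσ'b n _) ?_
      (fun n => (hφ n).continuous_gradient.aestronglyMeasurable) hu.memSobolev.memLp_grad hgrad
    · refine h1.congr fun n => ?_
      congr 1
      funext x
      rw [hgr, one_smul]
    · filter_upwards [hae, hu0] with x hx h0
      have h1 : Tendsto (fun n => σ' n (φ n x)) atTop
          (𝓝 (max (u x) 0 ^ 2 * (u x ^ 2 + 3 * 0) / (u x ^ 2 + 0) ^ 2)) := by
        refine (((hx.max tendsto_const_nhds).pow 2).mul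
          ((hx.pow 2).add (hδlim.const_mul 3))).div (((hx.pow 2).add hδlim).pow 2) ?_
        positivity
      convert h1 using 2
      rw [max_eq_left h0.le]
      field_simp
      ring

end TestLimit

/-! ### Admissible functions in the weak equation -/

section WeakEquation

variable {N : ℕ} {Ω : Set (EuclideanSpace ℝ (Fin N))} {p : ℝ}

theorem IsTestFun.integrable_mul {φ g : EuclideanSpace ℝ (Fin N) → ℝ} (hφ : IsTestFun 1 Ω φ)
    (hg : LocallyIntegrableOn g Ω volume) :
    Integrable (fun x => g x * φ x) (volume.restrict Ω) := by
  have hc : Continuous φ := (show ContDiff ℝ 1 φ from hφ.contDiff).continuous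
  have h1 : IntegrableOn (fun x => g x * φ x) (tsupport φ) volume :=
    (hg.integrableOn_compact_subset hφ.tsupport_subset hφ.hasCompactSupport).mul_continuousOn
      hc.continuousOn hφ.hasCompactSupport
  exact (h1.integrable_of_forall_notMem_eq_zero fun x hx => by
    rw [image_eq_zero_of_notMem_tsupport hx, mul_zero]).restrict

/-- `-div B = g` in `Ω` in the sense of distributions, for a vector field `B ∈ L^{p'}(Ω)`,
`1/p + 1/p' = 1`, and a nonnegative locally integrable function `g`. -/
structure HasDivergence (p : ℝ) (Ω : Set (EuclideanSpace ℝ (Fin N)))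
    (B : EuclideanSpace ℝ (Fin N) → EuclideanSpace ℝ (Fin N))
    (g : EuclideanSpace ℝ (Fin N) → ℝ) : Prop where
  memLp : MemLp B (ENNReal.ofReal p.conjExponent) (volume.restrict Ω)
  locallyIntegrableOn : LocallyIntegrableOn g Ω volume
  ae_nonneg : ∀ᵐ x ∂(volume.restrict Ω), 0 ≤ g x
  integral_eq : ∀ φ, IsTestFun 1 Ω φ →
    ∫ x in Ω, inner ℝ (B x) (gradient φ x) = ∫ x in Ω, g x * φ x

/-- The regularization of the harmonic mean of `s` and `t` (up to a factor): a `C¹` function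
that is at most `min s t`. -/
theorem isQuadrantC1_softMin {δ : ℝ} (hδ : 0 < δ) :
    IsQuadrantC1 (fun z => z.1 * z.2 / (z.1 + z.2 + δ))
      (fun z => z.2 * (z.2 + δ) / (z.1 + z.2 + δ) ^ 2)
      (fun z => z.1 * (z.1 + δ) / (z.1 + z.2 + δ) ^ 2) 1 where
  map_zero := by simp
  nonneg z h1 h2 := by positivity
  contDiffAt z h1 h2 := by
    have : z.1 + z.2 + δ ≠ 0 := by positivity
    exact ContDiffAt.div (by fun_prop) (by fun_prop) this
  hasFDerivAt z h1 h2 := by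
    have h0 : z.1 + z.2 + δ ≠ 0 := by positivity
    have h3 : HasFDerivAt (fun z : ℝ × ℝ => z.1) (ContinuousLinearMap.fst ℝ ℝ ℝ) z :=
      hasFDerivAt_fst
    have h4 : HasFDerivAt (fun z : ℝ × ℝ => z.2) (ContinuousLinearMap.snd ℝ ℝ ℝ) z :=
      hasFDerivAt_snd
    refine ((h3.mul h4).mul ((hasDerivAt_inv h0).comp_hasFDerivAt z
      ((h3.add h4).add_const δ))).congr_fderiv ?_
    ext <;> simp <;> field_simp <;> ring
  abs_le₁ z h1 h2 := by
    rw [abs_of_nonneg (by positivity), div_le_one (by positivity)]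
    nlinarith [mul_nonneg h1 h2, mul_nonneg h1 hδ.le, mul_nonneg h2 hδ.le]
  abs_le₂ z h1 h2 := by
    rw [abs_of_nonneg (by positivity), div_le_one (by positivity)]
    nlinarith [mul_nonneg h1 h2, mul_nonneg h1 hδ.le, mul_nonneg h2 hδ.le]

theorem isQuadrantC1_add :
    IsQuadrantC1 (fun z => z.1 + z.2) (fun _ => 1) (fun _ => 1) 1 where
  map_zero := by simp
  nonneg z h1 h2 := add_nonneg h1 h2
  contDiffAt z h1 h2 := by fun_prop
  hasFDerivAt z h1 h2 := by
    rw [one_smul, one_smul]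
    exact hasFDerivAt_fst.add hasFDerivAt_snd
  abs_le₁ z h1 h2 := by simp
  abs_le₂ z h1 h2 := by simp

namespace HasDivergence

variable {B : EuclideanSpace ℝ (Fin N) → EuclideanSpace ℝ (Fin N)}
  {g : EuclideanSpace ℝ (Fin N) → ℝ} {φ : ℕ → EuclideanSpace ℝ (Fin N) → ℝ}
  {w : EuclideanSpace ℝ (Fin N) → ℝ} {W : EuclideanSpace ℝ (Fin N) → EuclideanSpace ℝ (Fin N)}

theorem holderTriple (hp : 1 < p) :
    (ENNReal.ofReal p.conjExponent).HolderTriple (ENNReal.ofReal p) 1 :=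
  (Real.HolderConjugate.conjExponent hp).symm.ennrealOfReal

theorem integrable_inner (hB : HasDivergence p Ω B g) (hp : 1 < p)
    (hW : MemLp W (ENNReal.ofReal p) (volume.restrict Ω)) :
    Integrable (fun x => inner ℝ (B x) (W x)) (volume.restrict Ω) :=
  have := holderTriple hp
  hB.memLp.integrable_inner_of_holder hW

theorem tendsto_integral_mul (hB : HasDivergence p Ω B g) (hp : 1 < p)
    (hw : IsTestLimit p Ω φ w W) : Tendsto (fun n => ∫ x in Ω, g x * φ n x) atTop
      (𝓝 (∫ x in Ω, inner ℝ (B x) (W x))) := by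
  have := holderTriple hp
  refine (tendsto_integral_inner hB.memLp hw.memLp
    (fun n => (hw.isTestFun n).memLp_gradient _) hw.tendsto_gradient).congr fun n => ?_
  exact hB.integral_eq _ (hw.isTestFun n)

/-- The weak equation, tested with the limit of nonnegative test functions: Fatou's lemma gives
integrability and one inequality. -/
theorem integrable_mul_and_le (hB : HasDivergence p Ω B g) (hp : 1 < p)
    (hw : IsTestLimit p Ω φ w W) : Integrable (fun x => g x * w x) (volume.restrict Ω) ∧
      ∫ x in Ω, g x * w x ≤ ∫ x in Ω, inner ℝ (B x) (W x) := by
  refine integrable_and_integral_le_of_tendsto (f := fun n x => g x * φ n x)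
    (fun n => (hw.isTestFun n).integrable_mul hB.locallyIntegrableOn) (fun n => ?_) ?_
    (hB.tendsto_integral_mul hp hw)
  · filter_upwards [hB.ae_nonneg] with x hx
    exact mul_nonneg hx (hw.nonneg n x)
  · filter_upwards [hw.tendsto_ae] with x hx
    exact hx.const_mul _

/-- Compactly supported approximations from below, given by the regularized harmonic mean of `w`
and `φ k`, show that equality holds for positive `w`. -/
theorem integral_eq_of_pos (hB : HasDivergence p Ω B g) (hp : 1 < p)
    (hw : IsTestLimit p Ω φ w W) (hw0 : ∀ᵐ x ∂(volume.restrict Ω), 0 < w x) :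
    ∫ x in Ω, g x * w x = ∫ x in Ω, inner ℝ (B x) (W x) := by
  have := holderTriple hp
  have hp1 : 1 ≤ ENNReal.ofReal p := ENNReal.one_le_ofReal.2 hp.le
  have hgm : AEStronglyMeasurable g (volume.restrict Ω) :=
    hB.locallyIntegrableOn.aestronglyMeasurable
  set δ : ℕ → ℝ := fun n => 1 / ((n : ℝ) + 1) with hδdef
  have hδ : ∀ n, 0 < δ n := fun n => by positivity
  have hδlim : Tendsto δ atTop (𝓝 0) := tendsto_one_div_add_atTop_nhds_zero_nat
  set f : ℕ → ℝ × ℝ → ℝ := fun k z => z.1 * z.2 / (z.1 + z.2 + δ k) with hf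
  set f₁ : ℕ → ℝ × ℝ → ℝ := fun k z => z.2 * (z.2 + δ k) / (z.1 + z.2 + δ k) ^ 2 with hf₁
  set f₂ : ℕ → ℝ × ℝ → ℝ := fun k z => z.1 * (z.1 + δ k) / (z.1 + z.2 + δ k) ^ 2 with hf₂
  have hQ : ∀ k, IsQuadrantC1 (f k) (f₁ k) (f₂ k) 1 := fun k => isQuadrantC1_softMin (hδ k)
  have hfle₁ : ∀ k s t, 0 ≤ s → 0 ≤ t → f k (s, t) ≤ s := fun k s t hs ht => by
    have := hδ k
    change s * t / (s + t + δ k) ≤ s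
    rw [div_le_iff₀ (by positivity)]
    exact mul_le_mul_of_nonneg_left (by linarith) hs
  have hfle₂ : ∀ k s t, 0 ≤ s → 0 ≤ t → f k (s, t) ≤ t := fun k s t hs ht => by
    have := hδ k
    change s * t / (s + t + δ k) ≤ t
    rw [div_le_iff₀ (by positivity), mul_comm]
    exact mul_le_mul_of_nonneg_left (by linarith) ht
  have hT : ∀ k, IsTestLimit p Ω (fun n x => f k (φ n x, φ k x)) (fun x => f k (w x, φ k x))
      (fun x => f₁ k (w x, φ k x) • W x + f₂ k (w x, φ k x) • gradient (φ k) x) := fun k =>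
    (hQ k).isTestLimit_comp hp.le hw ((hw.isTestFun k).isTestLimit (hw.nonneg k))
  -- For fixed `k` the factor `φ k` makes `g` integrable.
  have hEq : ∀ k, ∫ x in Ω, g x * f k (w x, φ k x) = ∫ x in Ω, inner ℝ (B x)
      (f₁ k (w x, φ k x) • W x + f₂ k (w x, φ k x) • gradient (φ k) x) := fun k => by
    refine tendsto_nhds_unique ?_ (hB.tendsto_integral_mul hp (hT k))
    refine tendsto_integral_of_dominated_convergence (fun x => g x * φ k x)
      (fun n => hgm.mul ((hT k).isTestFun n).contDiff.continuous.aestronglyMeasurable)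
      ((hw.isTestFun k).integrable_mul hB.locallyIntegrableOn) (fun n => ?_) ?_
    · filter_upwards [hB.ae_nonneg] with x hx
      rw [Real.norm_of_nonneg (mul_nonneg hx ((hT k).nonneg n x))]
      exact mul_le_mul_of_nonneg_left (hfle₂ k _ _ (hw.nonneg n x) (hw.nonneg k x)) hx
    · filter_upwards [(hT k).tendsto_ae] with x hx
      exact hx.const_mul _
  -- As `k → ∞`, the function tends to `w / 2`, and its two partial derivatives tend to `1 / 4`.
  have hne : ∀ a : ℝ, 0 < a → a + a + 0 ≠ 0 := fun a ha => by positivity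
  have hLHS : Tendsto (fun k => ∫ x in Ω, g x * f k (w x, φ k x)) atTop
      (𝓝 (∫ x in Ω, g x * (w x / 2))) := by
    refine tendsto_integral_of_dominated_convergence (fun x => g x * w x)
      (fun k => hgm.mul (hT k).aestronglyMeasurable)
      (hB.integrable_mul_and_le hp hw).1 (fun k => ?_) ?_
    · filter_upwards [hB.ae_nonneg, hw.ae_nonneg] with x hx h0
      rw [Real.norm_of_nonneg (mul_nonneg hx ((hQ k).nonneg (_, _) h0 (hw.nonneg k x)))]
      exact mul_le_mul_of_nonneg_left (hfle₁ k _ _ h0 (hw.nonneg k x)) hx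
    · filter_upwards [hw.tendsto_ae, hw0] with x hx h0
      refine Tendsto.const_mul _ ?_
      have h1 : Tendsto (fun k => f k (w x, φ k x)) atTop (𝓝 (w x * w x / (w x + w x + 0))) :=
        (hx.const_mul (w x)).div ((hx.const_add (w x)).add hδlim) (hne _ h0)
      convert h1 using 2
      field_simp
      ring
  have hhalf : ∀ a : ℝ, 0 < a → a * (a + 0) / (a + a + 0) ^ 2 = 1 / 4 := fun a ha => by
    field_simp
    ring
  have hl₁ : ∀ᵐ x ∂(volume.restrict Ω),
      Tendsto (fun k => f₁ k (w x, φ k x)) atTop (𝓝 (1 / 4)) := by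
    filter_upwards [hw.tendsto_ae, hw0] with x hx h0
    rw [← hhalf _ h0]
    exact (hx.mul (hx.add hδlim)).div (((hx.const_add (w x)).add hδlim).pow 2)
      (pow_ne_zero 2 (hne _ h0))
  have hl₂ : ∀ᵐ x ∂(volume.restrict Ω),
      Tendsto (fun k => f₂ k (w x, φ k x)) atTop (𝓝 (1 / 4)) := by
    filter_upwards [hw.tendsto_ae, hw0] with x hx h0
    rw [← hhalf _ h0]
    exact ((hδlim.const_add (w x)).const_mul (w x)).div
      (((hx.const_add (w x)).add hδlim).pow 2) (pow_ne_zero 2 (hne _ h0))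
  have hwm := hw.aestronglyMeasurable.aemeasurable
  have hφm : ∀ k, AEMeasurable (φ k) (volume.restrict Ω) := fun k =>
    (hw.isTestFun k).contDiff.continuous.aemeasurable
  have hm₁ : ∀ k, AEStronglyMeasurable (fun x => f₁ k (w x, φ k x)) (volume.restrict Ω) :=
    fun k => (((hφm k).mul ((hφm k).add_const _)).div
      (((hwm.add (hφm k)).add_const _).pow_const 2)).aestronglyMeasurable
  have hm₂ : ∀ k, AEStronglyMeasurable (fun x => f₂ k (w x, φ k x)) (volume.restrict Ω) :=
    fun k => ((hwm.mul (hwm.add_const _)).div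
      (((hwm.add (hφm k)).add_const _).pow_const 2)).aestronglyMeasurable
  have hRHS : Tendsto (fun k => ∫ x in Ω, inner ℝ (B x)
      (f₁ k (w x, φ k x) • W x + f₂ k (w x, φ k x) • gradient (φ k) x)) atTop
      (𝓝 (∫ x in Ω, inner ℝ (B x) ((1 / 4 : ℝ) • W x + (1 / 4 : ℝ) • W x))) := by
    have hg : ∀ n, AEStronglyMeasurable (gradient (φ n)) (volume.restrict Ω) := fun n =>
      (hw.isTestFun n).continuous_gradient.aestronglyMeasurable
    have hW4 : MemLp (fun x => (1 / 4 : ℝ) • W x) (ENNReal.ofReal p) (volume.restrict Ω) :=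
      hw.memLp.const_smul (1 / 4 : ℝ)
    refine tendsto_integral_inner hB.memLp (hW4.add hW4) (fun k => (hT k).memLp) ?_
    refine tendsto_eLpNorm_add_sub hp1 (fun k => (hm₁ k).smul hw.memLp.1)
      (fun k => (hm₂ k).smul (hg k)) hW4.1 hW4.1 ?_ ?_
    · refine tendsto_eLpNorm_smul_sub (C := 1) hp1 ENNReal.ofReal_ne_top hm₁
        (fun k => ?_) hl₁
        (fun _ => hw.memLp.1) hw.memLp (by simp)
      filter_upwards [hw.ae_nonneg] with x h0
      exact (hQ k).abs_le₁ _ h0 (hw.nonneg k x)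
    · refine tendsto_eLpNorm_smul_sub (C := 1) hp1 ENNReal.ofReal_ne_top hm₂
        (fun k => ?_) hl₂
        hg hw.memLp hw.tendsto_gradient
      filter_upwards [hw.ae_nonneg] with x h0
      exact (hQ k).abs_le₂ _ h0 (hw.nonneg k x)
  have hfin := tendsto_nhds_unique (hLHS.congr hEq) hRHS
  have e1 : ∫ x in Ω, g x * (w x / 2) = (∫ x in Ω, g x * w x) * (1 / 2) := by
    rw [← integral_mul_const]
    exact integral_congr_ae (ae_of_all _ fun x => by ring)
  have e2 : ∫ x in Ω, inner ℝ (B x) ((1 / 4 : ℝ) • W x + (1 / 4 : ℝ) • W x) =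
      (∫ x in Ω, inner ℝ (B x) (W x)) * (1 / 2) := by
    rw [← integral_mul_const]
    refine integral_congr_ae (ae_of_all _ fun x => ?_)
    simp only [inner_add_right, real_inner_smul_right]
    ring
  rw [e1, e2] at hfin
  linarith

/-- A nonnegative limit of test functions is admissible in the weak equation, provided that there
is some positive one. -/
theorem integral_eq_of_isTestLimit (hB : HasDivergence p Ω B g)
    (hp : 1 < p) (hw : IsTestLimit p Ω φ w W) {ψ : ℕ → EuclideanSpace ℝ (Fin N) → ℝ}
    {v : EuclideanSpace ℝ (Fin N) → ℝ} {V : EuclideanSpace ℝ (Fin N) → EuclideanSpace ℝ (Fin N)}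
    (hv : IsTestLimit p Ω ψ v V) (hv0 : ∀ᵐ x ∂(volume.restrict Ω), 0 < v x) :
    ∫ x in Ω, g x * w x = ∫ x in Ω, inner ℝ (B x) (W x) := by
  have h1 := hB.integral_eq_of_pos hp hv hv0
  have h2 := hB.integral_eq_of_pos hp (isQuadrantC1_add.isTestLimit_comp hp.le hw hv) (by
    filter_upwards [hw.ae_nonneg, hv0] with x h h'
    exact add_pos_of_nonneg_of_pos h h')
  simp only [one_smul, inner_add_right, mul_add] at h2
  rw [integral_add (hB.integrable_mul_and_le hp hw).1 (hB.integrable_mul_and_le hp hv).1,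
    integral_add (hB.integrable_inner hp hw.memLp) (hB.integrable_inner hp hv.memLp)] at h2
  linarith

end HasDivergence

end WeakEquation

/-! ### Test functions for the comparison and pointwise inequalities -/

section TestFunctions

/-- The relative excess `(s - t)⁺ / (s + ε)` of `s` over `t`. -/
noncomputable def relExcess (ε s t : ℝ) : ℝ := max (s - t) 0 / (s + ε)

/-- A bounded and increasing `C¹` substitute for `s`, tending to `s` as `ε → 0`. -/
noncomputable def damp (ε s : ℝ) : ℝ := s / (1 + ε * s)

variable {ε s t p : ℝ}

theorem relExcess_nonneg (hε : 0 < ε) (hs : 0 ≤ s) : 0 ≤ relExcess ε s t :=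
  div_nonneg (le_max_right _ _) (by positivity)

theorem relExcess_le_one (hε : 0 < ε) (hs : 0 ≤ s) (ht : 0 ≤ t) : relExcess ε s t ≤ 1 := by
  rw [relExcess, div_le_one (by positivity)]
  exact max_le (by linarith) (by positivity)

theorem damp_nonneg (hε : 0 < ε) (hs : 0 ≤ s) : 0 ≤ damp ε s := by
  rw [damp]
  positivity

theorem damp_le (hε : 0 < ε) (hs : 0 ≤ s) : damp ε s ≤ 1 / ε := by
  rw [damp, div_le_div_iff₀ (by positivity) hε]
  linarith

theorem hasDerivAt_damp (hε : 0 < ε) (hs : 0 ≤ s) :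
    HasDerivAt (damp ε) (1 / (1 + ε * s) ^ 2) s := by
  have h0 : 1 + ε * s ≠ 0 := by positivity
  refine ((hasDerivAt_id s).div (((hasDerivAt_id s).const_mul ε).const_add 1) h0).congr_deriv ?_
  simp only [id, mul_one, one_mul]
  congr 1
  ring

theorem contDiffAt_damp (hε : 0 < ε) (hs : 0 ≤ s) : ContDiffAt ℝ 1 (damp ε) s := by
  have h0 : 1 + ε * s ≠ 0 := by positivity
  exact ContDiffAt.div (by fun_prop) (by fun_prop) h0

/-- The test function for the equation of the larger function `s`: in terms of the relative excess
`x` of `s` over `t` it is `(s + ε) x²`. -/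
theorem isQuadrantC1_upper (hε : 0 < ε) :
    IsQuadrantC1 (fun z => max (z.1 - z.2) 0 ^ 2 / (z.1 + ε))
      (fun z => 2 * relExcess ε z.1 z.2 - relExcess ε z.1 z.2 ^ 2)
      (fun z => -(2 * relExcess ε z.1 z.2)) 2 where
  map_zero := by simp
  nonneg z h1 h2 := by positivity
  contDiffAt z h1 h2 := by
    have h0 : z.1 + ε ≠ 0 := by positivity
    refine ContDiffAt.div ?_ (by fun_prop) h0
    exact contDiff_max_zero_sq.contDiffAt.comp z
      (show ContDiffAt ℝ 1 (fun z : ℝ × ℝ => z.1 - z.2) z by fun_prop)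
  hasFDerivAt z h1 h2 := by
    have h0 : z.1 + ε ≠ 0 := by positivity
    have h3 : HasFDerivAt (fun z : ℝ × ℝ => z.1) (ContinuousLinearMap.fst ℝ ℝ ℝ) z :=
      hasFDerivAt_fst
    have h4 : HasFDerivAt (fun z : ℝ × ℝ => z.2) (ContinuousLinearMap.snd ℝ ℝ ℝ) z :=
      hasFDerivAt_snd
    refine (((hasDerivAt_max_zero_sq (z.1 - z.2)).comp_hasFDerivAt z (h3.sub h4)).mul
      ((hasDerivAt_inv h0).comp_hasFDerivAt z (h3.add_const ε))).congr_fderiv ?_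
    ext <;> simp [relExcess] <;> field_simp
    ring
  abs_le₁ z h1 h2 := by
    have h3 := relExcess_nonneg (t := z.2) hε h1
    have h4 := relExcess_le_one hε h1 h2
    rw [abs_le]
    constructor <;> nlinarith
  abs_le₂ z h1 h2 := by
    have h3 := relExcess_nonneg (t := z.2) hε h1
    have h4 := relExcess_le_one hε h1 h2
    rw [abs_le]
    constructor <;> linarith

/-- The test function for the equation of the smaller function `t`. Its ratio to the test function
of `isQuadrantC1_upper` is `(s / t) ^ (p - 1)`, up to the regularization; damping `s` keeps the
partial derivatives bounded. -/
theorem isQuadrantC1_lower (hε : 0 < ε) (hp : 1 < p) :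
    IsQuadrantC1
      (fun z => (damp ε z.1 + ε) ^ (p - 2) * max (damp ε z.1 - z.2) 0 ^ 2 * (z.2 + ε) ^ (1 - p))
      (fun z => 1 / (1 + ε * z.1) ^ 2 * (((damp ε z.1 + ε) / (z.2 + ε)) ^ (p - 1) *
        (p * relExcess ε (damp ε z.1) z.2 ^ 2 +
          2 * (relExcess ε (damp ε z.1) z.2 * (1 - relExcess ε (damp ε z.1) z.2)))))
      (fun z => -(((damp ε z.1 + ε) / (z.2 + ε)) ^ p *
        ((p - 1) * relExcess ε (damp ε z.1) z.2 ^ 2 +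
          2 * (relExcess ε (damp ε z.1) z.2 * (1 - relExcess ε (damp ε z.1) z.2)))))
      (((((1 / ε + ε) / ε) ^ (p - 1)) + ((1 / ε + ε) / ε) ^ p) * (p + 2)) where
  map_zero := by simp [damp]
  nonneg z h1 h2 := by
    have := damp_nonneg hε h1
    positivity
  contDiffAt z h1 h2 := by
    have hS := damp_nonneg hε h1
    have h0 : damp ε z.1 + ε ≠ 0 := by positivity
    have h0' : z.2 + ε ≠ 0 := by positivity
    have h3 : ContDiffAt ℝ 1 (fun z : ℝ × ℝ => damp ε z.1) z :=
      (contDiffAt_damp hε h1).comp z contDiffAt_fst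
    have h4 : ContDiffAt ℝ 1 (fun z : ℝ × ℝ => z.2) z := contDiffAt_snd
    refine (ContDiffAt.mul ?_ ?_).mul ?_
    · exact (h3.add contDiffAt_const).rpow_const_of_ne h0
    · exact contDiff_max_zero_sq.contDiffAt.comp z (h3.sub h4)
    · exact (h4.add contDiffAt_const).rpow_const_of_ne h0'
  hasFDerivAt z h1 h2 := by
    have hS := damp_nonneg hε h1
    have hP : 0 < damp ε z.1 + ε := by positivity
    have hQ : 0 < z.2 + ε := by positivity
    have h3 : HasFDerivAt (fun z : ℝ × ℝ => damp ε z.1)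
        ((1 / (1 + ε * z.1) ^ 2) • ContinuousLinearMap.fst ℝ ℝ ℝ) z :=
      (hasDerivAt_damp hε h1).comp_hasFDerivAt z hasFDerivAt_fst
    have h4 : HasFDerivAt (fun z : ℝ × ℝ => z.2) (ContinuousLinearMap.snd ℝ ℝ ℝ) z :=
      hasFDerivAt_snd
    refine ((((h3.add_const ε).rpow_const (p := p - 2) (Or.inl hP.ne')).mul
      ((hasDerivAt_max_zero_sq (damp ε z.1 - z.2)).comp_hasFDerivAt z (h3.sub h4))).mul
      ((h4.add_const ε).rpow_const (p := 1 - p) (Or.inl hQ.ne'))).congr_fderiv ?_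
    simp only [Function.comp_apply, Pi.mul_apply]
    -- This relation turns `x / t` into `x * (1 - x)`.
    have hd : max (damp ε z.1 - z.2) 0 * (damp ε z.1 - z.2 - max (damp ε z.1 - z.2) 0) = 0 := by
      rcases le_total (damp ε z.1 - z.2) 0 with h | h
      · simp [max_eq_right h]
      · simp [max_eq_left h]
    generalize hσ : damp ε z.1 = S at *
    generalize hτ : z.2 = τ at *
    have hT : 0 < 1 + ε * z.1 := by positivity
    generalize 1 + ε * z.1 = T at *
    generalize hdd : max (S - τ) 0 = d at *
    have e1 : (S + ε) ^ (p - 2) = (S + ε) ^ (p - 1) / (S + ε) := by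
      rw [← Real.rpow_sub_one hP.ne']
      congr 1
      ring
    have e2 : (S + ε) ^ (p - 2 - 1) = (S + ε) ^ (p - 1) / (S + ε) / (S + ε) := by
      rw [Real.rpow_sub_one hP.ne', e1]
    have e3 : (τ + ε) ^ (1 - p - 1) = (τ + ε) ^ (1 - p) / (τ + ε) := Real.rpow_sub_one hQ.ne' _
    have e4 : ((S + ε) / (τ + ε)) ^ (p - 1) = (S + ε) ^ (p - 1) * (τ + ε) ^ (1 - p) := by
      rw [Real.div_rpow hP.le hQ.le, div_eq_mul_inv, ← Real.rpow_neg hQ.le, neg_sub]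
    have e5 : ((S + ε) / (τ + ε)) ^ p =
        (S + ε) ^ (p - 1) * (τ + ε) ^ (1 - p) * ((S + ε) / (τ + ε)) := by
      rw [← e4, Real.rpow_sub_one (by positivity), div_mul_cancel₀ _ (by positivity)]
    have hx : relExcess ε S τ = d / (S + ε) := by rw [relExcess, hdd]
    rw [e4, e5, hx]
    rw [e1, e2, e3]
    generalize (S + ε) ^ (p - 1) = A at *
    generalize (τ + ε) ^ (1 - p) = B at *
    ext
    · simp [hσ, hτ, hdd]
      field_simp
      ring
    · simp [hσ, hτ, hdd]
      field_simp
      linear_combination (2 * A * B) * hd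
  abs_le₁ z h1 h2 := by
    have hS := damp_nonneg hε h1
    have hx := relExcess_nonneg (t := z.2) hε hS
    have hx1 := relExcess_le_one hε hS h2
    have hR : (damp ε z.1 + ε) / (z.2 + ε) ≤ (1 / ε + ε) / ε :=
      div_le_div₀ (by positivity) (by linarith [damp_le hε h1]) hε (by linarith)
    have hR1 : ((damp ε z.1 + ε) / (z.2 + ε)) ^ (p - 1) ≤ ((1 / ε + ε) / ε) ^ (p - 1) :=
      Real.rpow_le_rpow (by positivity) hR (by linarith)
    have hR2 : 0 ≤ ((1 / ε + ε) / ε) ^ p := by positivity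
    generalize relExcess ε (damp ε z.1) z.2 = x at *
    have hb0 : 0 ≤ p * x ^ 2 + 2 * (x * (1 - x)) := by
      have := mul_nonneg hx (sub_nonneg.2 hx1)
      positivity
    have hb : p * x ^ 2 + 2 * (x * (1 - x)) ≤ p + 2 := by
      nlinarith [mul_le_mul_of_nonneg_left (pow_le_one₀ hx hx1 : x ^ 2 ≤ 1)
        (zero_le_one.trans hp.le)]
    have hc : 1 / (1 + ε * z.1) ^ 2 ≤ 1 := by
      rw [div_le_one (by positivity)]
      exact one_le_pow₀ (by nlinarith)
    rw [abs_of_nonneg (by positivity)]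
    calc _ ≤ 1 * (((1 / ε + ε) / ε) ^ (p - 1) * (p + 2)) :=
          mul_le_mul hc (mul_le_mul hR1 hb hb0 (by positivity)) (by positivity) zero_le_one
      _ ≤ _ := by
          rw [one_mul]
          exact mul_le_mul_of_nonneg_right (by linarith) (by linarith)
  abs_le₂ z h1 h2 := by
    have hS := damp_nonneg hε h1
    have hx := relExcess_nonneg (t := z.2) hε hS
    have hx1 := relExcess_le_one hε hS h2
    have hR : (damp ε z.1 + ε) / (z.2 + ε) ≤ (1 / ε + ε) / ε :=
      div_le_div₀ (by positivity) (by linarith [damp_le hε h1]) hε (by linarith)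
    have hR1 : ((damp ε z.1 + ε) / (z.2 + ε)) ^ p ≤ ((1 / ε + ε) / ε) ^ p :=
      Real.rpow_le_rpow (by positivity) hR (by linarith)
    have hR2 : 0 ≤ ((1 / ε + ε) / ε) ^ (p - 1) := by positivity
    generalize relExcess ε (damp ε z.1) z.2 = x at *
    have hb0 : 0 ≤ (p - 1) * x ^ 2 + 2 * (x * (1 - x)) := by
      have := mul_nonneg hx (sub_nonneg.2 hx1)
      have := mul_nonneg (sub_nonneg.2 hp.le) (sq_nonneg x)
      positivity
    have hb : (p - 1) * x ^ 2 + 2 * (x * (1 - x)) ≤ p + 2 := by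
      nlinarith [mul_le_mul_of_nonneg_left (pow_le_one₀ hx hx1 : x ^ 2 ≤ 1)
        (sub_nonneg.2 hp.le)]
    rw [abs_neg, abs_of_nonneg (mul_nonneg (by positivity) hb0)]
    calc _ ≤ ((1 / ε + ε) / ε) ^ p * (p + 2) := mul_le_mul hR1 hb hb0 (by positivity)
      _ ≤ _ := mul_le_mul_of_nonneg_right (by linarith) (by linarith)

end TestFunctions

section Pointwise

variable {N : ℕ} {H : EuclideanSpace ℝ (Fin N) → ℝ} {p : ℝ}

theorem rpow_mul_inner_finslerFlux (hH : IsFinslerNorm H) {t : ℝ} (ht : 0 < t)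
    (Y X : EuclideanSpace ℝ (Fin N)) :
    t ^ (p - 1) * inner ℝ (finslerFlux H p Y) X = inner ℝ (finslerFlux H p (t • Y)) X := by
  rw [finslerFlux_smul hH Y ht, real_inner_smul_left]

theorem rpow_mul_inner_finslerFlux_self (hH : IsFinslerNorm H) {t : ℝ} (ht : 0 < t)
    (Y : EuclideanSpace ℝ (Fin N)) :
    t ^ p * inner ℝ (finslerFlux H p Y) Y = inner ℝ (finslerFlux H p (t • Y)) (t • Y) := by
  rw [finslerFlux_smul hH Y ht, real_inner_smul_left, real_inner_smul_right,
    Real.rpow_sub_one ht.ne']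
  field_simp

/-- The energy density of the test function for the smaller function is bounded above, uniformly in
all parameters, by the energy density of the larger one. Here `X` and `Y` stand for the gradients of
the larger and the smaller function, `t` for their quotient, `x` for the relative excess and `c` for
the derivative of the damping. -/
theorem lower_density_le (hH : IsFinslerNorm H) (hp : 1 < p) {t x c : ℝ} (ht : 0 < t)
    (hx0 : 0 ≤ x) (hx1 : x ≤ 1) (hc0 : 0 ≤ c) (hc1 : c ≤ 1) (X Y : EuclideanSpace ℝ (Fin N)) :
    c * (t ^ (p - 1) * (p * x ^ 2 + 2 * (x * (1 - x)))) * inner ℝ (finslerFlux H p Y) X +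
      -(t ^ p * ((p - 1) * x ^ 2 + 2 * (x * (1 - x)))) * inner ℝ (finslerFlux H p Y) Y ≤
      3 * inner ℝ (finslerFlux H p X) X := by
  have h1 := rpow_mul_inner_finslerFlux (p := p) hH ht Y X
  have h2 := rpow_mul_inner_finslerFlux_self (p := p) hH ht Y
  have h3 := inner_finslerFlux_le hH hp (t • Y) X
  have h4 := inner_finslerFlux_self_nonneg (p := p) hH X
  have h5 := inner_finslerFlux_self_nonneg (p := p) hH (t • Y)
  have hn : 0 ≤ 2 * (x * (1 - x)) := by
    have := mul_nonneg hx0 (sub_nonneg.2 hx1)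
    positivity
  have hn1 : 2 * (x * (1 - x)) ≤ 2 := by nlinarith
  have hm : 0 ≤ x ^ 2 := sq_nonneg x
  have hm1 : x ^ 2 ≤ 1 := pow_le_one₀ hx0 hx1
  generalize 2 * (x * (1 - x)) = n at *
  generalize x ^ 2 = m at *
  have e : c * (t ^ (p - 1) * (p * m + n)) * inner ℝ (finslerFlux H p Y) X +
      -(t ^ p * ((p - 1) * m + n)) * inner ℝ (finslerFlux H p Y) Y =
      (p * m + n) * (c * inner ℝ (finslerFlux H p (t • Y)) X) -
        ((p - 1) * m + n) * inner ℝ (finslerFlux H p (t • Y)) (t • Y) := by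
    rw [← h1, ← h2]
    ring
  rw [e]
  generalize inner ℝ (finslerFlux H p (t • Y)) X = b at *
  generalize inner ℝ (finslerFlux H p (t • Y)) (t • Y) = z at *
  generalize inner ℝ (finslerFlux H p X) X = a at *
  have hp0 : 0 < p := by linarith
  have hab : 0 ≤ a + (p - 1) * z := add_nonneg h4 (mul_nonneg (by linarith) h5)
  have h6 : p * (c * b) ≤ a + (p - 1) * z := by
    have := mul_le_mul_of_nonneg_left h3 hc0
    nlinarith
  have h7 : (p * m + n) * (p * (c * b)) ≤ (p * m + n) * (a + (p - 1) * z) :=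
    mul_le_mul_of_nonneg_left h6 (by positivity)
  have h8 : (p * m + n) * a ≤ p * 3 * a := by
    refine mul_le_mul_of_nonneg_right ?_ h4
    nlinarith
  have h9 : 0 ≤ n * z := mul_nonneg hn h5
  refine le_of_mul_le_mul_left ?_ hp0
  nlinarith

/-- A Picone inequality for the two test functions: with `n = 2 x (1 - x)`, the difference of the
two sides is `x²` times the deficit in `inner_finslerFlux_le` for `tY, X`, plus `n / p` times the sum
of the deficits for `tY, X` and for `X, tY`. The relation `hxt` between the relative excess `x` and
the quotient `t` says that `x = 1 - 1 / t` unless `x = 0`. -/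
theorem lower_density_le_upper_density (hH : IsFinslerNorm H) (hp : 1 < p) {t x : ℝ} (ht : 0 < t)
    (hx0 : 0 ≤ x) (hx1 : x ≤ 1) (hxt : x * ((1 - x) * t) = x) (X Y : EuclideanSpace ℝ (Fin N)) :
    t ^ (p - 1) * (p * x ^ 2 + 2 * (x * (1 - x))) * inner ℝ (finslerFlux H p Y) X +
      -(t ^ p * ((p - 1) * x ^ 2 + 2 * (x * (1 - x)))) * inner ℝ (finslerFlux H p Y) Y ≤
    (2 * x - x ^ 2) * inner ℝ (finslerFlux H p X) X +
      -(2 * x) * inner ℝ (finslerFlux H p X) Y := by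
  have h1 := rpow_mul_inner_finslerFlux (p := p) hH ht Y X
  have h2 := rpow_mul_inner_finslerFlux_self (p := p) hH ht Y
  have h3 := inner_finslerFlux_le hH hp (t • Y) X
  have h4 := inner_finslerFlux_le hH hp X (t • Y)
  have h5 : inner ℝ (finslerFlux H p X) (t • Y) = t * inner ℝ (finslerFlux H p X) Y :=
    real_inner_smul_right _ _ _
  have hn : 0 ≤ 2 * (x * (1 - x)) := by
    have := mul_nonneg hx0 (sub_nonneg.2 hx1)
    positivity
  have e1 : t ^ (p - 1) * (p * x ^ 2 + 2 * (x * (1 - x))) * inner ℝ (finslerFlux H p Y) X +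
      -(t ^ p * ((p - 1) * x ^ 2 + 2 * (x * (1 - x)))) * inner ℝ (finslerFlux H p Y) Y =
      (p * x ^ 2 + 2 * (x * (1 - x))) * inner ℝ (finslerFlux H p (t • Y)) X -
        ((p - 1) * x ^ 2 + 2 * (x * (1 - x))) * inner ℝ (finslerFlux H p (t • Y)) (t • Y) := by
    rw [← h1, ← h2]
    ring
  have e2 : -(2 * x) * inner ℝ (finslerFlux H p X) Y =
      -(2 * (x * (1 - x))) * inner ℝ (finslerFlux H p X) (t • Y) := by
    rw [h5]
    linear_combination (2 * inner ℝ (finslerFlux H p X) Y) * hxt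
  rw [e1, e2]
  generalize inner ℝ (finslerFlux H p (t • Y)) X = b at *
  generalize inner ℝ (finslerFlux H p (t • Y)) (t • Y) = z at *
  generalize inner ℝ (finslerFlux H p X) X = a at *
  generalize inner ℝ (finslerFlux H p X) (t • Y) = b' at *
  have h6 : b + b' ≤ a + z := by
    refine le_of_mul_le_mul_left ?_ (by linarith : 0 < p)
    linarith
  have h7 := mul_le_mul_of_nonneg_left h6 hn
  have h8 := mul_le_mul_of_nonneg_left h3 (sq_nonneg x)
  linarith

end Pointwise

/-! ### Comparison and uniqueness -/

section Uniqueness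

variable {N : ℕ} {Ω : Set (EuclideanSpace ℝ (Fin N))} {H : EuclideanSpace ℝ (Fin N) → ℝ} {p : ℝ}
  {F : EuclideanSpace ℝ (Fin N) → ℝ → ℝ}

theorem memLp_finslerFlux (hH : IsFinslerNorm H) (hp : 1 < p)
    {G : EuclideanSpace ℝ (Fin N) → EuclideanSpace ℝ (Fin N)}
    {μ : Measure (EuclideanSpace ℝ (Fin N))} (hG : MemLp G (ENNReal.ofReal p) μ) :
    MemLp (fun x => finslerFlux H p (G x)) (ENNReal.ofReal p.conjExponent) μ := by
  obtain ⟨C, hC0, hC⟩ := exists_norm_finslerFlux_le hH p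
  have h1 := hG.norm_rpow_div (ENNReal.ofReal (p - 1))
  rw [← ENNReal.ofReal_div_of_pos (sub_pos.2 hp), ENNReal.toReal_ofReal (sub_pos.2 hp).le] at h1
  refine h1.of_le_mul (c := C)
    ((measurable_finslerFlux hH p).comp_aemeasurable hG.1.aemeasurable).aestronglyMeasurable
    (ae_of_all _ fun x => ?_)
  rw [Real.norm_of_nonneg (Real.rpow_nonneg (norm_nonneg _) _)]
  exact hC _

theorem IsWeakSolution.exists_isTestLimit (hΩ : MeasurableSet Ω) (hH : IsFinslerNorm H)
    (hp : 1 < p) (hF : IsCaratheodory Ω F) {u : EuclideanSpace ℝ (Fin N) → ℝ}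
    (hu : IsWeakSolution H p Ω F u) :
    ∃ φ G, IsTestLimit p Ω φ u G ∧ (∀ᵐ x ∂(volume.restrict Ω), 0 < u x) ∧
      HasDivergence p Ω (fun x => finslerFlux H p (G x)) (fun x => F x (u x)) := by
  obtain ⟨G, hG, hu0, hloc, heq⟩ := hu
  obtain ⟨φ, hφ⟩ := hG.exists_isTestLimit hp.le hu0
  refine ⟨φ, G, hφ, hu0, memLp_finslerFlux hH hp hφ.memLp, hloc, ?_, heq⟩
  filter_upwards [hu0, ae_restrict_mem hΩ] with x hx hxΩ
  exact hF.nonneg x hxΩ _ hx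

theorem tendsto_damp {δ : ℕ → ℝ} (hδ : Tendsto δ atTop (𝓝 0)) (s : ℝ) :
    Tendsto (fun k => damp (δ k) s) atTop (𝓝 s) := by
  have h1 : Tendsto (fun k => s / (1 + δ k * s)) atTop (𝓝 (s / (1 + 0 * s))) :=
    tendsto_const_nhds.div ((hδ.mul_const s).const_add 1) (by simp)
  rw [zero_mul, add_zero, div_one] at h1
  exact h1

theorem tendsto_relExcess {δ σ : ℕ → ℝ} (hδ : Tendsto δ atTop (𝓝 0)) {s : ℝ}
    (hσ : Tendsto σ atTop (𝓝 s)) (hs : 0 < s) (t : ℝ) :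
    Tendsto (fun k => relExcess (δ k) (σ k) t) atTop (𝓝 (relExcess 0 s t)) :=
  ((hσ.sub_const t).max tendsto_const_nhds).div (hσ.add hδ) (by simpa using hs.ne')

/-- If `f(s) / s^(p-1)` is strictly decreasing, then the limits of the two test functions are ordered
strictly where `s > t`, when weighted with the right-hand sides. -/
theorem source_mul_lt {f : ℝ → ℝ} (hf : StrictAntiOn (fun s : ℝ => f s / s ^ (p - 1)) (Ioi 0))
    {s t : ℝ} (ht : 0 < t) (hts : t < s) :
    f s * (max (s - t) 0 ^ 2 / s) < f t * (s ^ (p - 2) * max (s - t) 0 ^ 2 * t ^ (1 - p)) := by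
  have hs : 0 < s := ht.trans hts
  have h1 : f s / s ^ (p - 1) < f t / t ^ (p - 1) := hf ht hs hts
  rw [max_eq_left (sub_pos.2 hts).le]
  have e1 : s ^ (p - 2) = s ^ (p - 1) / s := by
    rw [← Real.rpow_sub_one hs.ne']
    congr 1
    ring
  have e2 : t ^ (1 - p) = (t ^ (p - 1))⁻¹ := by
    rw [← Real.rpow_neg ht.le, neg_sub]
  have hA : 0 < s ^ (p - 1) := Real.rpow_pos_of_pos hs _
  have hB : 0 < t ^ (p - 1) := Real.rpow_pos_of_pos ht _
  have hd : 0 < s - t := sub_pos.2 hts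
  calc f s * ((s - t) ^ 2 / s)
      = f s / s ^ (p - 1) * (s ^ (p - 1) * (s - t) ^ 2 / s) := by field_simp
    _ < f t / t ^ (p - 1) * (s ^ (p - 1) * (s - t) ^ 2 / s) :=
        mul_lt_mul_of_pos_right h1 (by positivity)
    _ = f t * (s ^ (p - 2) * (s - t) ^ 2 * t ^ (1 - p)) := by
        rw [e1, e2]
        field_simp

/-- Any two solutions are ordered almost everywhere: the equation of `u` is tested with `f k`, that
of `v` with `g k`, and the difference is passed to the limit by Fatou's lemma. -/
theorem IsWeakSolution.ae_le (hΩ : MeasurableSet Ω) (hH : IsFinslerNorm H) (hp : 1 < p)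
    (hF : IsCaratheodory Ω F)
    (hF_anti : ∀ᵐ x ∂(volume.restrict Ω), StrictAntiOn (fun s : ℝ => F x s / s ^ (p - 1)) (Ioi 0))
    {u v : EuclideanSpace ℝ (Fin N) → ℝ} (hu : IsWeakSolution H p Ω F u)
    (hv : IsWeakSolution H p Ω F v) : ∀ᵐ x ∂(volume.restrict Ω), u x ≤ v x := by
  obtain ⟨φ, U, hφ, hu0, hA⟩ := hu.exists_isTestLimit hΩ hH hp hF
  obtain ⟨ψ, V, hψ, hv0, hB⟩ := hv.exists_isTestLimit hΩ hH hp hF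
  set μ := volume.restrict Ω with hμ
  set a := fun x => inner ℝ (finslerFlux H p (U x)) (U x) with ha
  set b := fun x => inner ℝ (finslerFlux H p (U x)) (V x) with hb
  set c := fun x => inner ℝ (finslerFlux H p (V x)) (U x) with hc
  set d := fun x => inner ℝ (finslerFlux H p (V x)) (V x) with hd
  have hai : Integrable a μ := hA.integrable_inner hp hφ.memLp
  have hbi : Integrable b μ := hA.integrable_inner hp hψ.memLp
  have hui : Integrable (fun x => F x (u x) * u x) μ := (hA.integrable_mul_and_le hp hφ).1
  set δ : ℕ → ℝ := fun n => 1 / ((n : ℝ) + 1) with hδdef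
  have hδ : ∀ n, 0 < δ n := fun n => by positivity
  have hδlim : Tendsto δ atTop (𝓝 0) := tendsto_one_div_add_atTop_nhds_zero_nat
  -- The test functions for the equations of `u` and `v`, and their energy densities.
  set f : ℕ → EuclideanSpace ℝ (Fin N) → ℝ :=
    fun k x => max (u x - v x) 0 ^ 2 / (u x + δ k) with hf
  set g : ℕ → EuclideanSpace ℝ (Fin N) → ℝ := fun k x => (damp (δ k) (u x) + δ k) ^ (p - 2) *
    max (damp (δ k) (u x) - v x) 0 ^ 2 * (v x + δ k) ^ (1 - p) with hg
  set I : ℕ → EuclideanSpace ℝ (Fin N) → ℝ := fun k x =>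
    (2 * relExcess (δ k) (u x) (v x) - relExcess (δ k) (u x) (v x) ^ 2) * a x +
      -(2 * relExcess (δ k) (u x) (v x)) * b x with hI
  set J : ℕ → EuclideanSpace ℝ (Fin N) → ℝ := fun k x =>
    1 / (1 + δ k * u x) ^ 2 * (((damp (δ k) (u x) + δ k) / (v x + δ k)) ^ (p - 1) *
      (p * relExcess (δ k) (damp (δ k) (u x)) (v x) ^ 2 +
        2 * (relExcess (δ k) (damp (δ k) (u x)) (v x) *
          (1 - relExcess (δ k) (damp (δ k) (u x)) (v x))))) * c x +
    -(((damp (δ k) (u x) + δ k) / (v x + δ k)) ^ p *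
      ((p - 1) * relExcess (δ k) (damp (δ k) (u x)) (v x) ^ 2 +
        2 * (relExcess (δ k) (damp (δ k) (u x)) (v x) *
          (1 - relExcess (δ k) (damp (δ k) (u x)) (v x))))) * d x with hJ
  have hf_lim := fun k => (isQuadrantC1_upper (hδ k)).isTestLimit_comp hp.le hφ hψ
  have hg_lim := fun k => (isQuadrantC1_lower (hδ k) hp).isTestLimit_comp hp.le hφ hψ
  have hfi : ∀ k, Integrable (fun x => F x (u x) * f k x) μ := fun k =>
    (hA.integrable_mul_and_le hp (hf_lim k)).1
  have hgi : ∀ k, Integrable (fun x => F x (v x) * g k x) μ := fun k =>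
    (hB.integrable_mul_and_le hp (hg_lim k)).1
  have hI_eq : ∀ k x, inner ℝ (finslerFlux H p (U x))
      ((2 * relExcess (δ k) (u x) (v x) - relExcess (δ k) (u x) (v x) ^ 2) • U x +
        (-(2 * relExcess (δ k) (u x) (v x))) • V x) = I k x := fun k x => by
    rw [inner_add_right, real_inner_smul_right, real_inner_smul_right]
  have hIi : ∀ k, Integrable (I k) μ := fun k =>
    (hA.integrable_inner hp (hf_lim k).memLp).congr (ae_of_all _ (hI_eq k))
  have hfI : ∀ k, ∫ x, F x (u x) * f k x ∂μ = ∫ x, I k x ∂μ := fun k =>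
    (hA.integral_eq_of_isTestLimit hp (hf_lim k) hφ hu0).trans
      (integral_congr_ae (ae_of_all _ (hI_eq k)))
  have hJ_eq : ∀ k x, inner ℝ (finslerFlux H p (V x))
      ((1 / (1 + δ k * u x) ^ 2 * (((damp (δ k) (u x) + δ k) / (v x + δ k)) ^ (p - 1) *
        (p * relExcess (δ k) (damp (δ k) (u x)) (v x) ^ 2 +
          2 * (relExcess (δ k) (damp (δ k) (u x)) (v x) *
            (1 - relExcess (δ k) (damp (δ k) (u x)) (v x)))))) • U x +
      (-(((damp (δ k) (u x) + δ k) / (v x + δ k)) ^ p *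
        ((p - 1) * relExcess (δ k) (damp (δ k) (u x)) (v x) ^ 2 +
          2 * (relExcess (δ k) (damp (δ k) (u x)) (v x) *
            (1 - relExcess (δ k) (damp (δ k) (u x)) (v x)))))) • V x) = J k x := fun k x => by
    rw [inner_add_right, real_inner_smul_right, real_inner_smul_right]
  have hJi : ∀ k, Integrable (J k) μ := fun k =>
    (hB.integrable_inner hp (hg_lim k).memLp).congr (ae_of_all _ (hJ_eq k))
  have hgJ : ∀ k, ∫ x, F x (v x) * g k x ∂μ = ∫ x, J k x ∂μ := fun k =>
    (hB.integral_eq_of_isTestLimit hp (hg_lim k) hψ hv0).trans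
      (integral_congr_ae (ae_of_all _ (hJ_eq k)))
  -- Their limits as the regularization is removed.
  set f0 : EuclideanSpace ℝ (Fin N) → ℝ := fun x => max (u x - v x) 0 ^ 2 / u x with hf0
  set g0 : EuclideanSpace ℝ (Fin N) → ℝ :=
    fun x => u x ^ (p - 2) * max (u x - v x) 0 ^ 2 * v x ^ (1 - p) with hg0
  set I0 : EuclideanSpace ℝ (Fin N) → ℝ := fun x =>
    (2 * relExcess 0 (u x) (v x) - relExcess 0 (u x) (v x) ^ 2) * a x +
      -(2 * relExcess 0 (u x) (v x)) * b x with hI0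
  set J0 : EuclideanSpace ℝ (Fin N) → ℝ := fun x =>
    (u x / v x) ^ (p - 1) * (p * relExcess 0 (u x) (v x) ^ 2 +
        2 * (relExcess 0 (u x) (v x) * (1 - relExcess 0 (u x) (v x)))) * c x +
    -((u x / v x) ^ p * ((p - 1) * relExcess 0 (u x) (v x) ^ 2 +
        2 * (relExcess 0 (u x) (v x) * (1 - relExcess 0 (u x) (v x))))) * d x with hJ0
  have hf_tend : ∀ᵐ x ∂μ, Tendsto (fun k => f k x) atTop (𝓝 (f0 x)) := by
    filter_upwards [hu0] with x hx
    exact tendsto_const_nhds.div (by simpa using hδlim.const_add (u x)) hx.ne'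
  have hg_tend : ∀ᵐ x ∂μ, Tendsto (fun k => g k x) atTop (𝓝 (g0 x)) := by
    filter_upwards [hu0, hv0] with x hx hx'
    have h1 := tendsto_damp hδlim (u x)
    have h2 : Tendsto (fun k => damp (δ k) (u x) + δ k) atTop (𝓝 (u x)) := by
      simpa using h1.add hδlim
    have h3 : Tendsto (fun k => v x + δ k) atTop (𝓝 (v x)) := by
      simpa using hδlim.const_add (v x)
    exact ((h2.rpow_const (Or.inl hx.ne')).mul
      (((h1.sub_const (v x)).max tendsto_const_nhds).pow 2)).mul (h3.rpow_const (Or.inl hx'.ne'))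
  have hI_tend : ∀ᵐ x ∂μ, Tendsto (fun k => I k x) atTop (𝓝 (I0 x)) := by
    filter_upwards [hu0] with x hx
    have h1 := tendsto_relExcess hδlim (tendsto_const_nhds (x := u x)) hx (v x)
    exact (((h1.const_mul 2).sub (h1.pow 2)).mul_const _).add ((h1.const_mul 2).neg.mul_const _)
  have hJ_tend : ∀ᵐ x ∂μ, Tendsto (fun k => J k x) atTop (𝓝 (J0 x)) := by
    filter_upwards [hu0, hv0] with x hx hx'
    have h1 := tendsto_damp hδlim (u x)
    have h2 : Tendsto (fun k => (damp (δ k) (u x) + δ k) / (v x + δ k)) atTop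
        (𝓝 (u x / v x)) := by
      refine Tendsto.div ?_ ?_ hx'.ne'
      · simpa using h1.add hδlim
      · simpa using hδlim.const_add (v x)
    have h3 := tendsto_relExcess hδlim h1 hx (v x)
    have h4 := (h3.mul (h3.const_sub 1)).const_mul 2
    have ht : u x / v x ≠ 0 := (div_pos hx hx').ne'
    have h5 : Tendsto (fun k => 1 / (1 + δ k * u x) ^ 2) atTop (𝓝 1) := by
      have : Tendsto (fun k => 1 / (1 + δ k * u x) ^ 2) atTop (𝓝 (1 / (1 + 0 * u x) ^ 2)) :=
        tendsto_const_nhds.div (((hδlim.mul_const (u x)).const_add 1).pow 2) (by simp)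
      simpa using this
    have h6 := (h5.mul ((h2.rpow_const (p := p - 1) (Or.inl ht)).mul
      (((h3.pow 2).const_mul p).add h4))).mul_const (c x)
    rw [one_mul] at h6
    exact h6.add (((h2.rpow_const (p := p) (Or.inl ht)).mul
      (((h3.pow 2).const_mul (p - 1)).add h4)).neg.mul_const (d x))
  -- Fatou's lemma for the difference of the two equations, after adding an integrable function
  -- that makes the integrands nonnegative.
  set M : EuclideanSpace ℝ (Fin N) → ℝ :=
    fun x => 3 * a x + F x (u x) * u x + 2 * |a x| + 2 * |b x| with hM
  have hMi : Integrable M μ :=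
    (((hai.const_mul 3).add hui).add (hai.abs.const_mul 2)).add (hbi.abs.const_mul 2)
  have hfatou := integrable_and_integral_le_of_tendsto (μ := μ)
    (f := fun k x => F x (v x) * g k x - J k x + (I k x - F x (u x) * f k x) + M x)
    (F := fun x => F x (v x) * g0 x - J0 x + (I0 x - F x (u x) * f0 x) + M x)
    (L := ∫ x, M x ∂μ)
    (fun k => (((hgi k).sub (hJi k)).add ((hIi k).sub (hfi k))).add hMi) ?_ ?_ ?_
  rotate_left
  · intro k
    filter_upwards [hu0, hv0, hA.ae_nonneg, hB.ae_nonneg] with x hx hx' hFu hFv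
    have hS := damp_nonneg (hδ k) hx.le
    have h1 : J k x ≤ 3 * a x :=
      lower_density_le hH hp (div_pos (add_pos_of_nonneg_of_pos hS (hδ k)) (add_pos hx' (hδ k)))
        (relExcess_nonneg (hδ k) hS) (relExcess_le_one (hδ k) hS hx'.le)
        (by have := hδ k; positivity)
        (by
          have := mul_pos (hδ k) hx
          rw [div_le_one (by positivity)]
          exact one_le_pow₀ (by linarith)) (U x) (V x)
    have h2 : 0 ≤ F x (v x) * g k x :=
      mul_nonneg hFv ((isQuadrantC1_lower (hδ k) hp).nonneg (u x, v x) hx.le hx'.le)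
    have h3 : F x (u x) * f k x ≤ F x (u x) * u x := by
      refine mul_le_mul_of_nonneg_left ?_ hFu
      have := hδ k
      change max (u x - v x) 0 ^ 2 / (u x + δ k) ≤ u x
      rw [div_le_iff₀ (by positivity), sq]
      exact mul_le_mul (max_le (by linarith) hx.le) (max_le (by linarith) (by positivity))
        (le_max_right _ _) hx.le
    have h4 : -(2 * |a x| + 2 * |b x|) ≤ I k x := by
      have e3 : |I k x| ≤ 2 * |a x| + 2 * |b x| := by
        refine (abs_add_le _ _).trans (add_le_add ?_ ?_)
        · rw [abs_mul]
          exact mul_le_mul_of_nonneg_right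
            ((isQuadrantC1_upper (hδ k)).abs_le₁ (u x, v x) hx.le hx'.le) (abs_nonneg _)
        · rw [abs_mul]
          exact mul_le_mul_of_nonneg_right
            ((isQuadrantC1_upper (hδ k)).abs_le₂ (u x, v x) hx.le hx'.le) (abs_nonneg _)
      exact (abs_le.1 e3).1
    simp only [Pi.zero_apply, hM]
    linarith
  · filter_upwards [hf_tend, hg_tend, hI_tend, hJ_tend] with x h1 h2 h3 h4
    exact (((h2.const_mul _).sub h4).add (h3.sub (h1.const_mul _))).add_const _
  · refine tendsto_const_nhds.congr fun k => ?_
    have e1 := integral_add (((hgi k).sub (hJi k)).add ((hIi k).sub (hfi k))) hMi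
    have e2 := integral_add ((hgi k).sub (hJi k)) ((hIi k).sub (hfi k))
    have e3 := integral_sub (hgi k) (hJi k)
    have e4 := integral_sub (hIi k) (hfi k)
    simp only [Pi.add_apply, Pi.sub_apply] at e1 e2 e3 e4
    rw [e1, e2, e3, e4, hgJ k, hfI k]
    ring
  obtain ⟨hint, hle⟩ := hfatou
  -- By the pointwise inequalities the limit integrand is nonnegative, hence it vanishes.
  have hkey : ∀ᵐ x ∂μ, J0 x ≤ I0 x := by
    filter_upwards [hu0, hv0] with x hx hx'
    have e0 : 0 ≤ relExcess 0 (u x) (v x) :=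
      div_nonneg (le_max_right _ _) (by simpa using hx.le)
    have e1 : relExcess 0 (u x) (v x) ≤ 1 := by
      rw [relExcess, add_zero, div_le_one hx]
      exact max_le (by linarith) hx.le
    refine lower_density_le_upper_density hH hp (div_pos hx hx') e0 e1 ?_ (U x) (V x)
    rw [relExcess, add_zero]
    rcases le_total (u x - v x) 0 with h | h
    · simp [max_eq_right h]
    · rw [max_eq_left h]
      field_simp
      ring
  have hsrc : ∀ᵐ x ∂μ, F x (u x) * f0 x ≤ F x (v x) * g0 x ∧
      (v x < u x → F x (u x) * f0 x < F x (v x) * g0 x) := by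
    filter_upwards [hu0, hv0, hF_anti] with x hx hx' hanti
    rcases lt_or_ge (v x) (u x) with h | h
    · exact ⟨(source_mul_lt hanti hx' h).le, fun _ => source_mul_lt hanti hx' h⟩
    · refine ⟨?_, fun h' => absurd h' (not_lt.2 h)⟩
      simp [hf0, hg0, max_eq_right (sub_nonpos.2 h)]
  have hzero : (fun x => F x (v x) * g0 x - J0 x + (I0 x - F x (u x) * f0 x)) =ᵐ[μ] 0 := by
    have hi : Integrable (fun x => F x (v x) * g0 x - J0 x + (I0 x - F x (u x) * f0 x)) μ :=
      (hint.sub hMi).congr (ae_of_all _ fun x => by simp)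
    have h0 : 0 ≤ᵐ[μ] fun x => F x (v x) * g0 x - J0 x + (I0 x - F x (u x) * f0 x) := by
      filter_upwards [hkey, hsrc] with x h1 h2
      simp only [Pi.zero_apply]
      linarith [h2.1]
    rw [integral_add hi hMi] at hle
    exact (integral_eq_zero_iff_of_nonneg_ae h0 hi).1
      (le_antisymm (by linarith) (integral_nonneg_of_ae h0))
  filter_upwards [hzero, hkey, hsrc] with x h0 h1 h2
  by_contra hcon
  have h3 := h2.2 (not_le.1 hcon)
  simp only [Pi.zero_apply] at h0
  linarith

end Uniqueness

theorem theorem1p1 {N : ℕ} (Ω : Set (EuclideanSpace ℝ (Fin N))) (hΩ : IsOpen Ω)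
    (hΩb : Bornology.IsBounded Ω) (H : EuclideanSpace ℝ (Fin N) → ℝ) (hH : IsFinslerNorm H)
    (p : ℝ) (hp : 1 < p) (hpN : p < N) (F : EuclideanSpace ℝ (Fin N) → ℝ → ℝ)
    (hF : IsCaratheodory Ω F)
    (hF_anti : ∀ᵐ x ∂(volume.restrict Ω), StrictAntiOn (fun s : ℝ => F x s / s ^ (p - 1)) (Ioi 0))
    (u v : EuclideanSpace ℝ (Fin N) → ℝ)
    (hu : IsWeakSolution H p Ω F u) (hv : IsWeakSolution H p Ω F v) :
    u =ᵐ[volume.restrict Ω] v := by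
  filter_upwards [hu.ae_le hΩ.measurableSet hH hp hF hF_anti hv,
    hv.ae_le hΩ.measurableSet hH hp hF hF_anti hu] with x h1 h2
  exact le_antisymm h1 h2
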